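/- Let $X\subseteq\mathbb{R}^D$ be convex and let $\rho$ be a measurable probability density on $\mathbb{R}^D$ that vanishes outside $X$ and is comparable on $X$ to a strongly log-concave function: there are $0<c\le C$ and a function $V$, strongly convex on $X$, with $c\,e^{-V}\le\rho\le C\,e^{-V}$ on $X$. (For example: $X$ bounded and $\rho$ bounded above and away from $0$ on $X$; or $X=\mathbb{R}^D$ and $\rho$ a nondegenerate Gaussian density.) Then there is a constant $C_1=C_1(X,\rho)>0$ such that the following holds for all integers $1\le d<D$, $N\ge 1$, $s\ge 0$ and all data as described below. *Function and active subspace.* Let $f$ be a measurable real function, differentiable in the interior of $X$, with $f$ and $\nabla f$ in $L^2(\rho)$. Let $\Sigma_f=\int_X\nabla f(x)\,\nabla f(x)^\top\rho(x)\,dx=W\,\mathrm{diag}(\lambda_1,\dots,\lambda_D)\,W^\top$ with $W$ orthogonal and $\lambda_1\ge\dots\ge\lambda_D$. Let $\hat W$ be an orthogonal matrix (the computed one) with $\|W-\hat W\|_2\le\delta_1$, and write $\hat W=[\hat W_1,\hat W_2]$, where $\hat W_1$ consists of the first $d$ columns. *Monte Carlo.* Put $p_Y(y)=\int_{\mathbb{R}^{D-d}}\rho(\hat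 W_1y+\hat W_2z)\,dz$ and, when $p_Y(y)>0$, $p_{Z|Y}(z|y)=\rho(\hat W_1y+\hat W_2z)/p_Y(y)$. Let $z_1(y),\dots,z_N(y)$ be random points, jointly measurable in $y$ and the random outcome, which for each $y$ with $p_Y(y)>0$ are independent with density $p_{Z|Y}(\cdot|y)$. Put $f_{\mathrm{MC}}(y)=\frac1N\sum_{i=1}^N f(\hat W_1y+\hat W_2z_i(y))$ and, for a bias $\beta\ge 0$, $f^{(\beta)}_{\mathrm{MC}}=f_{\mathrm{MC}}+\beta$. *Gaussian process regression.* Let $k$ be a measurable (symmetric, positive semidefinite) covariance kernel on $\mathbb{R}^d$ and let $y_{\mathrm{tr}}=(y_1,\dots,y_s)$ be fixed training points in $\hat W_1^\top X$ for which the Gram matrix $k(y_{\mathrm{tr}},y_{\mathrm{tr}})$ is invertible. Let $$f^{(\beta)}_{\mathrm{GPR}}(y)=k(y,y_{\mathrm{tr}})\,k(y_{\mathrm{tr}},y_{\mathrm{tr}})^{-1}\big(f^{(\beta)}_{\mathrm{MC}}(y_j)\big)_{j=1}^s$$ be the mean of the noiseless Gaussian process regression trained on the biased data. For a random function $g$ on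 $X$ write $\|g\|_{2,\rho}=\big(\mathbb{E}\int_X g(x)^2\rho(x)\,dx\big)^{1/2}$, the expectation being over the Monte Carlo samples; functions of $y$ are evaluated at $y=\hat W_1^\top x$. If $C_2,\delta_2\ge 0$ satisfy $\|f^{(\beta)}_{\mathrm{MC}}-f^{(\beta)}_{\mathrm{GPR}}\|_{2,\rho}\le C_2\delta_2$, then $$\|f-f^{(\beta)}_{\mathrm{GPR}}\|_{2,\rho}\le C_1\Big(1+\frac1{\sqrt N}\Big)\Big(\delta_1\sqrt{\textstyle\sum_{i=1}^d\lambda_i}+\sqrt{\textstyle\sum_{i=d+1}^D\lambda_i}\Big)+C_2\delta_2+\beta .$$ -/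

import Mathlib

open MeasureTheory ProbabilityTheory

noncomputable section

namespace ActiveSubspace

/-- `ℝⁿ` with its Euclidean norm and Lebesgue measure. -/
abbrev E (n : ℕ) : Type := EuclideanSpace ℝ (Fin n)

/-- A probability density `ρ` on a convex domain `X ⊆ ℝᴰ`, extended by zero outside `X`, that is
comparable on `X`, up to multiplicative constants `0 < c ≤ C`, to a strongly log-concave function
`exp (-V)`. For bounded `X` this contains every density that is bounded above and away from zero
on `X` (take `V x = ‖x‖² / 2`); for `X = ℝᴰ` it contains the nondegenerate Gaussian densities. -/
structure IsAdmissibleDensity {D : ℕ} (X : Set (E D)) (ρ : E D → ℝ) : Prop where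
  convex : Convex ℝ X
  measurable : Measurable ρ
  eq_zero_of_notMem : ∀ x, x ∉ X → ρ x = 0
  integral_eq_one : ∫ x, ρ x = 1
  comparable : ∃ (V : E D → ℝ) (α c C : ℝ), 0 < α ∧ 0 < c ∧ StrongConvexOn X α V ∧
    ∀ x ∈ X, c * Real.exp (-V x) ≤ ρ x ∧ ρ x ≤ C * Real.exp (-V x)

/-- The measure `ρ(x) dx`. -/
def densityMeasure {D : ℕ} (ρ : E D → ℝ) : Measure (E D) :=
  volume.withDensity fun x => ENNReal.ofReal (ρ x)

/-- The matrix `Σ_f = ∫ ∇f(x) ⊗ ∇f(x) ρ(x) dx`. -/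
def gradientCovariance {D : ℕ} (ρ f : E D → ℝ) : Matrix (Fin D) (Fin D) ℝ :=
  Matrix.of fun i j => ∫ x, gradient f x i * gradient f x j ∂(densityMeasure ρ)

/-- `S = W Λ Wᵀ` with `W` orthogonal and `Λ = diag(lam)`, `lam` in decreasing order. -/
structure IsEigendecomposition {D : ℕ} (S W : Matrix (Fin D) (Fin D) ℝ) (lam : Fin D → ℝ) :
    Prop where
  orthogonal : W ∈ Matrix.orthogonalGroup (Fin D) ℝ
  antitone : Antitone lam
  eq_mul : S = W * Matrix.diagonal lam * W.transpose

/-- `W₁`: the first `d` columns of `W`. -/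
def activeBlock {D d : ℕ} (hd : d < D) (W : Matrix (Fin D) (Fin D) ℝ) :
    Matrix (Fin D) (Fin d) ℝ :=
  W.submatrix id (Fin.castLE hd.le)

/-- `W₂`: the last `D - d` columns of `W`. -/
def inactiveBlock {D d : ℕ} (_hd : d < D) (W : Matrix (Fin D) (Fin D) ℝ) :
    Matrix (Fin D) (Fin (D - d)) ℝ :=
  W.submatrix id fun j => ⟨d + j.val, by omega⟩

/-- The active variable `y = W₁ᵀ x`. -/
def activeVar {D d : ℕ} (hd : d < D) (W : Matrix (Fin D) (Fin D) ℝ) (x : E D) : E d :=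
  WithLp.toLp 2 ((activeBlock hd W).transpose.mulVec x.ofLp)

/-- The point `W₁ y + W₂ z`. -/
def recombine {D d : ℕ} (hd : d < D) (W : Matrix (Fin D) (Fin D) ℝ) (y : E d) (z : E (D - d)) :
    E D :=
  WithLp.toLp 2 ((activeBlock hd W).mulVec y.ofLp + (inactiveBlock hd W).mulVec z.ofLp)

/-- The marginal density `p_Y(y) = ∫ ρ(W₁ y + W₂ z) dz`. -/
def marginalDensity {D d : ℕ} (hd : d < D) (W : Matrix (Fin D) (Fin D) ℝ) (ρ : E D → ℝ)
    (y : E d) : ℝ :=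
  ∫ z : E (D - d), ρ (recombine hd W y z)

/-- The conditional density `p_{Z|Y}(z|y) = ρ(W₁ y + W₂ z) / p_Y(y)`. -/
def condDensity {D d : ℕ} (hd : d < D) (W : Matrix (Fin D) (Fin D) ℝ) (ρ : E D → ℝ)
    (y : E d) (z : E (D - d)) : ℝ :=
  ρ (recombine hd W y z) / marginalDensity hd W ρ y

/-- A Monte Carlo sampler: for every `y` with `p_Y(y) > 0`, the points `Z 1 · y, …, Z N · y` are
independent with density `p_{Z|Y}(·|y)`. Nothing is assumed on the dependence between different
values of `y` besides joint measurability. -/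
structure IsConditionalSampler {D d N : ℕ} (hd : d < D) (W : Matrix (Fin D) (Fin D) ℝ)
    (ρ : E D → ℝ) {Ω : Type*} [MeasurableSpace Ω] (P : Measure Ω)
    (Z : Fin N → Ω → E d → E (D - d)) : Prop where
  measurable : ∀ i, Measurable fun p : Ω × E d => Z i p.1 p.2
  law : ∀ i y, 0 < marginalDensity hd W ρ y →
    P.map (fun ω => Z i ω y) =
      volume.withDensity fun z => ENNReal.ofReal (condDensity hd W ρ y z)
  indep : ∀ y, 0 < marginalDensity hd W ρ y → iIndepFun (fun i ω => Z i ω y) P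

/-- The Monte Carlo estimator `f_MC(y) = N⁻¹ ∑ᵢ f(W₁ y + W₂ zᵢ)`. -/
def fMC {D d N : ℕ} (hd : d < D) (W : Matrix (Fin D) (Fin D) ℝ) (f : E D → ℝ) {Ω : Type*}
    (Z : Fin N → Ω → E d → E (D - d)) (ω : Ω) (y : E d) : ℝ :=
  (1 / (N : ℝ)) * ∑ i, f (recombine hd W y (Z i ω y))

/-- The biased Monte Carlo estimator `f_MC^{(β)} = f_MC + β`. -/
def fMCBiased {D d N : ℕ} (hd : d < D) (W : Matrix (Fin D) (Fin D) ℝ) (f : E D → ℝ) {Ω : Type*}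
    (Z : Fin N → Ω → E d → E (D - d)) (β : ℝ) (ω : Ω) (y : E d) : ℝ :=
  fMC hd W f Z ω y + β

/-- A (measurable) covariance kernel: symmetric and positive semidefinite. -/
structure IsCovarianceKernel {d : ℕ} (k : E d → E d → ℝ) : Prop where
  measurable : Measurable fun p : E d × E d => k p.1 p.2
  posSemidef : ∀ (n : ℕ) (p : Fin n → E d), (Matrix.of fun i j => k (p i) (p j)).PosSemidef

/-- The Gram matrix `k(y_tr, y_tr)`. -/
def gram {d s : ℕ} (k : E d → E d → ℝ) (ytr : Fin s → E d) : Matrix (Fin s) (Fin s) ℝ :=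
  Matrix.of fun i j => k (ytr i) (ytr j)

/-- The mean `k(y, y_tr) (k(y_tr, y_tr) + σ² I)⁻¹ f_tr` of Gaussian process regression with noise
variance `σ²`. -/
def gprMean {d s : ℕ} (k : E d → E d → ℝ) (noiseVar : ℝ) (ytr : Fin s → E d) (ftr : Fin s → ℝ)
    (y : E d) : ℝ :=
  dotProduct (fun i => k y (ytr i))
    ((gram k ytr + noiseVar • (1 : Matrix (Fin s) (Fin s) ℝ))⁻¹.mulVec ftr)

/-- The noiseless GPR surrogate `f_GPR^{(β)}` trained on the biased data
`f_MC^{(β)}(y_1), …, f_MC^{(β)}(y_s)`. -/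
def fGPRBiased {D d N s : ℕ} (hd : d < D) (W : Matrix (Fin D) (Fin D) ℝ) (f : E D → ℝ)
    {Ω : Type*} (Z : Fin N → Ω → E d → E (D - d)) (k : E d → E d → ℝ) (ytr : Fin s → E d)
    (β : ℝ) (ω : Ω) (y : E d) : ℝ :=
  gprMean k 0 ytr (fun i => fMCBiased hd W f Z β ω (ytr i)) y

/-- The norm `‖g‖_{2,ρ} = (𝔼 ∫ g(x)² ρ(x) dx)^{1/2}` of a random function `g` on `X`. -/
def rmsNorm {D : ℕ} (ρ : E D → ℝ) {Ω : Type*} [MeasurableSpace Ω] (P : Measure Ω)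
    (g : Ω → E D → ℝ) : ENNReal :=
  eLpNorm (fun p : E D × Ω => g p.2 p.1) 2 ((densityMeasure ρ).prod P)

end ActiveSubspace

end

noncomputable section

namespace ActiveSubspace

open Set Filter Topology ENNReal
open scoped Convolution

/-! The heart is a Poincaré inequality on the fibers `{W₁ y + W₂ z}`, with a constant depending only
on the modulus `α` and on `c`, `C`. It is used in the form `∬ |f(x) - f(y)|² dμ dμ ≤ const · μ(univ)
· ∫ ‖∇f‖² dμ`. This form needs no mean value and its sides are monotone in `μ`, so it passes from a
strongly log-concave weight to a comparable one.

For strongly log-concave weights it comes from Prékopa-Leindler: midpoint Brunn-Minkowski on the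
line, layer cake, and induction on the dimension. A strongly log-concave weight then gives Maurey's
inequality (`lintegral_mul_lintegral_le_of_strongConvexOn`), whose second-order expansion around
constants is Poincaré for smooth compactly supported functions. Mollification and an exhaustion from
inside extend it to differentiable functions on an open convex set
(`lintegral_lintegral_sq_sub_le_of_isOpen`).

Restricting to a fiber preserves the strong convexity modulus, and the gradient along the fiber is
`W₂ᵀ ∇f`. Given `y`, the point `x` and a sample contribute two independent copies of the conditional
law, so the mean square of `f(x)` minus the sampled value is exactly a fiber double integral.
Integrating over `y` bounds it by a multiple of `∫ ‖W₂ᵀ ∇f‖² ρ` (`lintegral_sq_sub_sample_le`).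

That integral equals `∑ᵢ λᵢ ∑ⱼ ⟨wᵢ, ŵⱼ⟩²` over inactive `j`. The inner sum is at most `1` always,
and at most `δ₁²` for active `i`, because `wᵢ` is orthogonal to the exact inactive columns
(`lintegral_inactiveVar_gradient_le`). Minkowski's inequality over the samples, the bias and the
regression error concludes. -/

/-! ### Brunn-Minkowski on the line and the Prékopa-Leindler inequality. -/

theorem volume_add_le_of_midpoint_mem_of_isCompact {A B C : Set ℝ} (hA : IsCompact A)
    (hB : IsCompact B) (hA0 : A.Nonempty) (hB0 : B.Nonempty)
    (h : ∀ a ∈ A, ∀ b ∈ B, (a + b) / 2 ∈ C) :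
    volume A + volume B ≤ 2 * volume C := by
  obtain ⟨a, ha, ha'⟩ := hA.exists_isGreatest hA0
  obtain ⟨b, hb, hb'⟩ := hB.exists_isLeast hB0
  -- With `a = max A` and `b = min B`, the translates `A + b` and `a + B` both lie in `2C` and can
  -- meet only at the point `a + b`.
  have hsub : ((fun x => x + b) '' A) ∪ ((fun x => a + x) '' B) ⊆ (fun x => 2 * x) '' C := by
    rintro _ (⟨x, hx, rfl⟩ | ⟨x, hx, rfl⟩)
    · exact ⟨(x + b) / 2, h x hx b hb, by ring⟩
    · exact ⟨(a + x) / 2, h a ha x hx, by ring⟩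
  have h2C : volume ((fun x : ℝ => 2 * x) '' C) = 2 * volume C := by
    have := Measure.addHaar_image_linearMap (volume : Measure ℝ)
      (LinearMap.mulLeft ℝ (2 : ℝ)) C
    have e : ((LinearMap.mulLeft ℝ (2 : ℝ)) '' C) = (fun x : ℝ => 2 * x) '' C := by
      ext; simp
    have e2 : LinearMap.det (LinearMap.mulLeft ℝ (2 : ℝ)) = 2 := by
      have : LinearMap.mulLeft ℝ (2 : ℝ) = (2 : ℝ) • LinearMap.id := by ext; simp
      rw [this, LinearMap.det_smul]; simp
    rw [e, e2] at this
    simpa using this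
  have hB2 : MeasurableSet ((fun x => a + x) '' B) :=
    (hB.image (by fun_prop)).measurableSet
  have hdis : AEDisjoint volume ((fun x => x + b) '' A) ((fun x => a + x) '' B) := by
    refine measure_mono_null (t := {a + b}) ?_ (by simp)
    rintro _ ⟨⟨x, hx, rfl⟩, ⟨y, hy, hxy⟩⟩
    have h1 := ha' hx
    have h2 := hb' hy
    simp only at hxy
    simp only [mem_singleton_iff]; linarith
  calc volume A + volume B
      = volume ((fun x => x + b) '' A) + volume ((fun x => a + x) '' B) := by
        simp
    _ = volume (((fun x => x + b) '' A) ∪ ((fun x => a + x) '' B)) :=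
        (measure_union₀ hB2.nullMeasurableSet hdis).symm
    _ ≤ _ := (measure_mono hsub).trans h2C.le

/-- The one-dimensional Brunn-Minkowski inequality for midpoints. -/
theorem volume_add_le_of_midpoint_mem {A B C : Set ℝ} (hA : MeasurableSet A)
    (hB : MeasurableSet B) (hA0 : A.Nonempty) (hB0 : B.Nonempty)
    (h : ∀ a ∈ A, ∀ b ∈ B, (a + b) / 2 ∈ C) :
    volume A + volume B ≤ 2 * volume C := by
  obtain ⟨a, ha⟩ := hA0
  obtain ⟨b, hb⟩ := hB0
  rw [hA.measure_eq_iSup_isCompact, hB.measure_eq_iSup_isCompact]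
  simp only [iSup_and']
  refine ENNReal.biSup_add_biSup_le' (p := fun K => K ⊆ A ∧ IsCompact K)
    (q := fun K => K ⊆ B ∧ IsCompact K) ⟨∅, by simp⟩ ⟨∅, by simp⟩ ?_
  rintro K ⟨hKA, hK⟩ L ⟨hLB, hL⟩
  -- The approximating compact sets may be empty; inserting fixed points of `A` and `B` makes them
  -- nonempty.
  calc volume K + volume L ≤ volume (insert a K) + volume (insert b L) :=
        add_le_add (measure_mono (subset_insert _ _)) (measure_mono (subset_insert _ _))
    _ ≤ 2 * volume C := by
        refine volume_add_le_of_midpoint_mem_of_isCompact (hK.insert a) (hL.insert b)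
          (insert_nonempty _ _) (insert_nonempty _ _) fun x hx y hy => h x ?_ y ?_
        · exact insert_subset ha hKA hx
        · exact insert_subset hb hLB hy

/-- Layer cake plus Brunn-Minkowski for the superlevel sets. Both suprema being `1` matters: below
level `1` both sets are nonempty, as Brunn-Minkowski requires, and from level `1` on both are empty.
-/
theorem lintegral_add_le_of_superlevel_midpoint {f g h : ℝ → ℝ} (hf : Measurable f)
    (hg : Measurable g) (hh : Measurable h) (f0 : ∀ x, 0 ≤ f x) (g0 : ∀ x, 0 ≤ g x)
    (h0 : ∀ x, 0 ≤ h x) (f1 : ∀ x, f x ≤ 1) (g1 : ∀ x, g x ≤ 1)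
    (fs : ∀ s < 1, ∃ x, s < f x) (gs : ∀ s < 1, ∃ x, s < g x)
    (H : ∀ s, 0 < s → ∀ x y, s < f x → s < g y → s < h ((x + y) / 2)) :
    (∫⁻ x, ENNReal.ofReal (f x)) + (∫⁻ x, ENNReal.ofReal (g x))
      ≤ 2 * ∫⁻ x, ENNReal.ofReal (h x) := by
  have lay : ∀ u : ℝ → ℝ, Measurable u → (∀ x, 0 ≤ u x) →
      ∫⁻ x, ENNReal.ofReal (u x) = ∫⁻ t in Ioi 0, volume {a : ℝ | t < u a} := fun u hu u0 =>
    lintegral_eq_lintegral_meas_lt volume (Eventually.of_forall u0) hu.aemeasurable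
  rw [lay f hf f0,
    lay g hg g0,
    lay h hh h0]
  have mono : ∀ u : ℝ → ℝ, Measurable fun t : ℝ => volume {a : ℝ | t < u a} := fun u =>
    Antitone.measurable fun s t hst => measure_mono fun a ha => lt_of_le_of_lt hst ha
  rw [← lintegral_add_left (mono f), ← lintegral_const_mul _ (mono h)]
  refine setLIntegral_mono' measurableSet_Ioi fun s hs => ?_
  rcases lt_or_ge s 1 with h1 | h1
  · obtain ⟨x, hx⟩ := fs s h1
    obtain ⟨y, hy⟩ := gs s h1
    exact volume_add_le_of_midpoint_mem (measurableSet_lt measurable_const hf)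
      (measurableSet_lt measurable_const hg) ⟨x, hx⟩ ⟨y, hy⟩ fun a ha b hb => H s hs a b ha hb
  · have e1 : {a | s < f a} = ∅ := by
      ext a; simpa using (f1 a).trans h1
    have e2 : {a | s < g a} = ∅ := by
      ext a; simpa using (g1 a).trans h1
    simp [e1, e2]

theorem four_mul_le_sq_add (x y : ℝ≥0∞) : 4 * (x * y) ≤ (x + y) ^ 2 := by
  rcases eq_or_ne x ∞ with rfl | hx
  · simp
  rcases eq_or_ne y ∞ with rfl | hy
  · simp
  lift x to NNReal using hx
  lift y to NNReal using hy
  norm_cast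
  rw [← NNReal.coe_le_coe]
  push_cast
  nlinarith [sq_nonneg ((x : ℝ) - y)]

/-- The Prékopa-Leindler inequality for midpoints, on a space where midpoints make sense. -/
def MidpointPrekopaLeindler (α : Type*) [AddCommGroup α] [Module ℝ α] [MeasurableSpace α]
    (μ : Measure α) : Prop :=
  ∀ F G H : α → ℝ≥0∞, Measurable F → Measurable G → Measurable H →
    (∀ x y, F x * G y ≤ H ((2⁻¹ : ℝ) • (x + y)) ^ 2) →
    (∫⁻ x, F x ∂μ) * (∫⁻ x, G x ∂μ) ≤ (∫⁻ x, H x ∂μ) ^ 2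

/-- Dividing `F` and `G` by their suprema `a`, `b`, and `H` by `√(ab)`, reduces to the additive
inequality for functions with common supremum `1`. The arithmetic-geometric mean inequality then
turns the sum of the two integrals into their product. -/
theorem prekopaLeindler_real_of_bounded {F G H : ℝ → ℝ≥0∞} (hF : Measurable F) (hG : Measurable G)
    (hH : Measurable H) (hFs : ⨆ x, F x ≠ ∞) (hGs : ⨆ x, G x ≠ ∞)
    (h : ∀ x y, F x * G y ≤ H ((2⁻¹ : ℝ) • (x + y)) ^ 2) :
    (∫⁻ x, F x) * (∫⁻ x, G x) ≤ (∫⁻ x, H x) ^ 2 := by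
  set a := ⨆ x, F x with ha
  set b := ⨆ x, G x with hb
  rcases eq_or_ne a 0 with ha0 | ha0
  · have : ∀ x, F x = 0 := fun x => le_antisymm (ha0 ▸ le_iSup F x) zero_le
    simp [this]
  rcases eq_or_ne b 0 with hb0 | hb0
  · have : ∀ x, G x = 0 := fun x => le_antisymm (hb0 ▸ le_iSup G x) zero_le
    simp [this]
  set c := (a * b) ^ (2⁻¹ : ℝ) with hc
  have hcc : c ^ 2 = a * b := by
    rw [hc, ← ENNReal.rpow_natCast, ← ENNReal.rpow_mul]; simp
  have hab0 : a * b ≠ 0 := mul_ne_zero ha0 hb0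
  have hab : a * b ≠ ∞ := ENNReal.mul_ne_top hFs hGs
  have hc0 : c ≠ 0 := by rintro h0; rw [h0] at hcc; simp at hcc; tauto
  have hct : c ≠ ∞ := by rintro h0; rw [h0] at hcc; simp at hcc; exact hab hcc.symm
  have F1 : ∀ x, F x / a ≤ 1 := fun x => ENNReal.div_le_of_le_mul (by simpa using le_iSup F x)
  have G1 : ∀ x, G x / b ≤ 1 := fun x => ENNReal.div_le_of_le_mul (by simpa using le_iSup G x)
  have Ft : ∀ x, F x / a ≠ ∞ := fun x => ne_top_of_le_ne_top one_ne_top (F1 x)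
  have Gt : ∀ x, G x / b ≠ ∞ := fun x => ne_top_of_le_ne_top one_ne_top (G1 x)
  -- Truncating `H / c` at `1` makes it real-valued and loses nothing, since only levels below `1`
  -- matter.
  have Ht : ∀ x, min (H x / c) 1 ≠ ∞ := fun x => ne_top_of_le_ne_top one_ne_top (min_le_right _ _)
  have sup : ∀ (u : ℝ → ℝ≥0∞) (A : ℝ≥0∞), A = ⨆ x, u x → A ≠ 0 → A ≠ ∞ → (∀ x, u x / A ≠ ∞) →
      ∀ s < 1, ∃ x, s < (u x / A).toReal := by
    intro u A hA hA0 hAt ut s hs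
    rcases lt_or_ge s 0 with hs0 | hs0
    · exact ⟨0, hs0.trans_le toReal_nonneg⟩
    have : ENNReal.ofReal s * A < ⨆ x, u x := by
      rw [← hA]
      calc ENNReal.ofReal s * A < 1 * A := by
            rw [ENNReal.mul_lt_mul_iff_left hA0 hAt]
            simpa using hs
        _ = A := one_mul A
    obtain ⟨x, hx⟩ := lt_iSup_iff.1 this
    refine ⟨x, ?_⟩
    rw [← ENNReal.ofReal_lt_iff_lt_toReal hs0 (ut x)]
    rwa [ENNReal.lt_div_iff_mul_lt (Or.inl hA0) (Or.inl hAt)]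
  have main := lintegral_add_le_of_superlevel_midpoint (f := fun x => (F x / a).toReal)
    (g := fun x => (G x / b).toReal) (h := fun x => (min (H x / c) 1).toReal)
    (hF.div_const a).ennreal_toReal (hG.div_const b).ennreal_toReal
    ((hH.div_const c).min measurable_const).ennreal_toReal
    (fun _ => toReal_nonneg) (fun _ => toReal_nonneg) (fun _ => toReal_nonneg)
    (fun x => by simpa using ENNReal.toReal_mono one_ne_top (F1 x))
    (fun x => by simpa using ENNReal.toReal_mono one_ne_top (G1 x))
    (sup F a ha ha0 hFs Ft) (sup G b hb hb0 hGs Gt) ?_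
  · simp only [ofReal_toReal (Ft _), ofReal_toReal (Gt _), ofReal_toReal (Ht _)] at main
    have main2 : (∫⁻ x, F x) / a + (∫⁻ x, G x) / b ≤ 2 * ((∫⁻ x, H x) / c) := by
      simp only [div_eq_mul_inv] at main ⊢
      rw [lintegral_mul_const _ hF, lintegral_mul_const _ hG] at main
      refine main.trans ?_
      rw [← lintegral_mul_const _ hH]
      gcongr
      exact min_le_left _ _
    have main3 := (four_mul_le_sq_add ((∫⁻ x, F x) / a) ((∫⁻ x, G x) / b)).trans
      (pow_le_pow_left₀ zero_le main2 2)
    have e1 : (∫⁻ x, F x) / a * ((∫⁻ x, G x) / b)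
        = (∫⁻ x, F x) * (∫⁻ x, G x) / (a * b) := by
      simp only [div_eq_mul_inv]
      rw [ENNReal.mul_inv (Or.inl ha0) (Or.inl hFs)]
      ring
    have e2 : (2 * ((∫⁻ x, H x) / c)) ^ 2 = 4 * ((∫⁻ x, H x) ^ 2 / (a * b)) := by
      rw [← hcc]
      simp only [div_eq_mul_inv, ENNReal.inv_pow]
      ring
    rw [e1, e2, ENNReal.mul_le_mul_iff_right (by norm_num) (by norm_num),
      ENNReal.div_le_iff hab0 hab, ENNReal.div_mul_cancel hab0 hab] at main3
    exact main3
  · intro s hs x y hx hy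
    have hs1 : s < 1 := hx.trans_le (by simpa using ENNReal.toReal_mono one_ne_top (F1 x))
    rw [← ENNReal.ofReal_lt_iff_lt_toReal hs.le (Ft x),
      ENNReal.lt_div_iff_mul_lt (Or.inl ha0) (Or.inl hFs)] at hx
    rw [← ENNReal.ofReal_lt_iff_lt_toReal hs.le (Gt y),
      ENNReal.lt_div_iff_mul_lt (Or.inl hb0) (Or.inl hGs)] at hy
    rw [← ENNReal.ofReal_lt_iff_lt_toReal hs.le (Ht _), lt_min_iff,
      ENNReal.lt_div_iff_mul_lt (Or.inl hc0) (Or.inl hct)]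
    refine ⟨?_, by simpa using hs1⟩
    have := (ENNReal.mul_lt_mul hx hy).trans_le (h x y)
    have e3 : ENNReal.ofReal s * a * (ENNReal.ofReal s * b) = (ENNReal.ofReal s * c) ^ 2 := by
      rw [mul_pow, hcc]; ring
    rw [e3] at this
    have e4 : (x + y) / 2 = (2⁻¹ : ℝ) • (x + y) := by
      rw [smul_eq_mul]; ring
    rw [e4]
    exact lt_of_not_ge fun hle => absurd this (not_lt.2 (pow_le_pow_left' hle 2))

theorem midpointPrekopaLeindler_real : MidpointPrekopaLeindler ℝ volume := by
  intro F G H hF hG hH h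
  have key : ∀ m : ℕ, (∫⁻ x, min (F x) m) * (∫⁻ x, min (G x) m) ≤ (∫⁻ x, H x) ^ 2 := fun m =>
    prekopaLeindler_real_of_bounded (hF.min measurable_const) (hG.min measurable_const) hH
      (ne_top_of_le_ne_top (natCast_ne_top m) (iSup_le fun x => min_le_right _ _))
      (ne_top_of_le_ne_top (natCast_ne_top m) (iSup_le fun x => min_le_right _ _))
      fun x y => (mul_le_mul' (min_le_left _ _) (min_le_left _ _)).trans (h x y)
  have lim : ∀ u : ℝ → ℝ≥0∞, Measurable u →
      ∫⁻ x, u x = ⨆ m : ℕ, ∫⁻ x, min (u x) m := by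
    intro u hu
    rw [← lintegral_iSup (fun m => hu.min measurable_const)
      fun m n hmn x => min_le_min le_rfl (by exact_mod_cast hmn)]
    refine lintegral_congr fun x => ?_
    rw [← inf_iSup_eq (u x) (fun m : ℕ => (m : ℝ≥0∞)), ENNReal.iSup_natCast, inf_top_eq]
  have mono : ∀ u : ℝ → ℝ≥0∞, Monotone fun m : ℕ => ∫⁻ x, min (u x) m := fun u m n hmn =>
    lintegral_mono fun x => min_le_min le_rfl (by exact_mod_cast hmn)
  rw [lim F hF, lim G hG, ENNReal.iSup_mul]
  refine iSup_le fun m => ?_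
  rw [ENNReal.mul_iSup]
  refine iSup_le fun n => ?_
  exact (mul_le_mul' (mono F (le_max_left m n)) (mono G (le_max_right m n))).trans (key _)

/-- The inequality tensorizes: applied on `β` to the slices over `x`, `y` and their midpoint, it
yields precisely the hypothesis on `α` for the partial integrals. -/
theorem MidpointPrekopaLeindler.prod {α β : Type*} [AddCommGroup α] [Module ℝ α]
    [MeasurableSpace α] [AddCommGroup β] [Module ℝ β] [MeasurableSpace β] {μ : Measure α}
    {ν : Measure β} [SFinite μ] [SFinite ν] (hα : MidpointPrekopaLeindler α μ)
    (hβ : MidpointPrekopaLeindler β ν) : MidpointPrekopaLeindler (α × β) (μ.prod ν) := by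
  intro F G H hF hG hH h
  rw [lintegral_prod _ hF.aemeasurable, lintegral_prod _ hG.aemeasurable,
    lintegral_prod _ hH.aemeasurable]
  refine hα _ _ _ hF.lintegral_prod_right' hG.lintegral_prod_right' hH.lintegral_prod_right' ?_
  intro x y
  refine hβ _ _ _ (by fun_prop) (by fun_prop) (by fun_prop) fun s t => ?_
  exact h (x, s) (y, t)

theorem MidpointPrekopaLeindler.of_measurePreserving {α β : Type*} [AddCommGroup α] [Module ℝ α]
    [MeasurableSpace α] [AddCommGroup β] [Module ℝ β] [MeasurableSpace β] {μ : Measure α}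
    {ν : Measure β} (e : α →ₗ[ℝ] β) (he : MeasurePreserving e μ ν)
    (hα : MidpointPrekopaLeindler α μ) : MidpointPrekopaLeindler β ν := by
  intro F G H hF hG hH h
  rw [← he.lintegral_comp hF, ← he.lintegral_comp hG, ← he.lintegral_comp hH]
  refine hα _ _ _ (hF.comp he.measurable) (hG.comp he.measurable) (hH.comp he.measurable) ?_
  intro x y
  simpa using h (e x) (e y)

theorem midpointPrekopaLeindler_pi (n : ℕ) : MidpointPrekopaLeindler (Fin n → ℝ) volume := by
  induction n with
  | zero =>
    intro F G H hF hG hH h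
    have hv : (volume : Measure (Fin 0 → ℝ)) = Measure.dirac 0 := by
      rw [volume_pi, Measure.pi_of_empty _ 0]
    rw [hv, lintegral_dirac, lintegral_dirac, lintegral_dirac]
    simpa using h 0 0
  | succ n ih =>
    let e : (ℝ × (Fin n → ℝ)) →ₗ[ℝ] (Fin (n + 1) → ℝ) :=
      { toFun := fun p => Fin.cons p.1 p.2
        map_add' := fun p q => by
          ext i; refine Fin.cases ?_ (fun j => ?_) i <;> simp
        map_smul' := fun c p => by
          ext i; refine Fin.cases ?_ (fun j => ?_) i <;> simp }
    refine MidpointPrekopaLeindler.of_measurePreserving e ?_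
      (midpointPrekopaLeindler_real.prod ih)
    have := (volume_preserving_piFinSuccAbove (fun _ : Fin (n + 1) => ℝ) 0).symm
    have he : ⇑e = (MeasurableEquiv.piFinSuccAbove (fun _ : Fin (n + 1) => ℝ) 0).symm := by
      funext p
      simp [e, MeasurableEquiv.piFinSuccAbove, Fin.insertNthEquiv]
    rw [he]
    exact this

theorem midpointPrekopaLeindler_euclidean (n : ℕ) : MidpointPrekopaLeindler (E n) volume :=
  MidpointPrekopaLeindler.of_measurePreserving
    (WithLp.linearEquiv 2 ℝ (Fin n → ℝ)).symm.toLinearMap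
    (PiLp.volume_preserving_toLp (Fin n)) (midpointPrekopaLeindler_pi n)

/-! ### Maurey's inequality and the Poincaré inequality for test functions. -/

/-- First-order Taylor bound with the derivative taken at `x` only: in Maurey's inequality the
gradient term must be absorbed by a function of `x` alone. -/
theorem sub_le_norm_fderiv_mul_add_sq {F : Type*} [NormedAddCommGroup F] [NormedSpace ℝ F]
    {g : F → ℝ} (hg : Differentiable ℝ g) {L : NNReal}
    (hL : LipschitzWith L (fderiv ℝ g)) (x y : F) :
    g x - g y ≤ ‖fderiv ℝ g x‖ * ‖x - y‖ + L * ‖x - y‖ ^ 2 := by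
  have h := (convex_segment y x).norm_image_sub_le_of_norm_hasFDerivWithin_le'
    (f := g) (f' := fderiv ℝ g) (φ := fderiv ℝ g x) (C := L * ‖x - y‖)
    (fun z _ => (hg z).hasFDerivAt.hasFDerivWithinAt) (fun z hz => by
      have h1 := hL.dist_le_mul z x
      rw [dist_eq_norm, dist_eq_norm] at h1
      refine h1.trans ?_
      gcongr
      rw [norm_sub_rev z x, norm_sub_rev x y]
      obtain ⟨a, b, ha, hb, hab, rfl⟩ := hz
      obtain rfl : b = 1 - a := by linarith
      have : x - (a • y + (1 - a) • x) = a • (x - y) := by module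
      rw [this, norm_smul, norm_sub_rev y x, Real.norm_of_nonneg ha]
      exact mul_le_of_le_one_left (norm_nonneg _) (by linarith))
    (left_mem_segment ℝ y x) (right_mem_segment ℝ y x)
  have h2 := (le_abs_self _).trans (h : |_| ≤ _)
  have h3 := (le_abs_self _).trans ((fderiv ℝ g x).le_opNorm (x - y) : |_| ≤ _)
  nlinarith

/-- Second-order expansion of `exp` at `t = εΔ - ε²q`. The cross term of `t² / 2` costs at most
`ε³AQ`, and the Taylor remainder at most `|t|³ ≤ ε³(A + Q)³`; both are uniform in `Δ` and `q`. -/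
theorem exp_perturbation_lower_bound {ε Δ q A Q : ℝ} (hε : 0 < ε) (hε1 : ε ≤ 1)
    (hεS : ε * (A + Q) ≤ 1) (hΔ : |Δ| ≤ A) (q0 : 0 ≤ q) (hq : q ≤ Q) :
    1 + ε * Δ - ε ^ 2 * q + ε ^ 2 * Δ ^ 2 / 2 - ε ^ 3 * (A * Q + (A + Q) ^ 3)
      ≤ Real.exp (ε * Δ - ε ^ 2 * q) := by
  set t := ε * Δ - ε ^ 2 * q with ht
  have hA : 0 ≤ A := (abs_nonneg _).trans hΔ
  have hQ : 0 ≤ Q := q0.trans hq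
  have htS : |t| ≤ ε * (A + Q) := by
    calc |t| ≤ |ε * Δ| + |ε ^ 2 * q| := abs_sub _ _
      _ = ε * |Δ| + ε * (ε * q) := by
          rw [abs_mul, abs_of_pos hε, abs_of_nonneg (mul_nonneg (sq_nonneg ε) q0)]
          ring
      _ ≤ ε * A + ε * (1 * Q) := by gcongr
      _ = _ := by ring
  have hb := Real.exp_bound (htS.trans hεS) (n := 3) (by norm_num)
  simp only [Finset.sum_range_succ, Finset.sum_range_zero, Nat.factorial] at hb
  have hb2 := neg_le_of_abs_le hb
  have h3 : |t| ^ 3 ≤ ε ^ 3 * (A + Q) ^ 3 := by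
    rw [← mul_pow]; exact pow_le_pow_left₀ (abs_nonneg _) htS 3
  have h4 : Δ * q ≤ A * Q := mul_le_mul ((le_abs_self _).trans hΔ) hq q0 hA
  have h5 : ε ^ 3 * (Δ * q) ≤ ε ^ 3 * (A * Q) := mul_le_mul_of_nonneg_left h4 (by positivity)
  have h6 : t ^ 2 = ε ^ 2 * Δ ^ 2 - 2 * (ε ^ 3 * (Δ * q)) + (ε ^ 2 * q) ^ 2 := by
    rw [ht]; ring
  have h7 : (0 : ℝ) ≤ |t| ^ 3 := by positivity
  norm_num at hb2
  nlinarith [sq_nonneg (ε ^ 2 * q)]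

/-- Maurey's inequality: the consequence of the Prékopa-Leindler inequality for a strongly
log-concave weight. -/
theorem lintegral_mul_lintegral_le_of_strongConvexOn {n : ℕ} {K : Set (E n)} {V : E n → ℝ} {α : ℝ}
    (hV : StrongConvexOn K α V)
    (hm : Measurable (K.indicator fun x => ENNReal.ofReal (Real.exp (-V x))))
    {u v : E n → ℝ} (hu : Measurable u) (hv : Measurable v)
    (huv : ∀ x y, u x + v y ≤ α / 4 * ‖x - y‖ ^ 2) :
    (∫⁻ x, ENNReal.ofReal (Real.exp (u x))
        ∂(volume.withDensity (K.indicator fun x => ENNReal.ofReal (Real.exp (-V x))))) *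
      (∫⁻ x, ENNReal.ofReal (Real.exp (v x))
        ∂(volume.withDensity (K.indicator fun x => ENNReal.ofReal (Real.exp (-V x)))))
    ≤ (volume.withDensity (K.indicator fun x => ENNReal.ofReal (Real.exp (-V x))) univ) ^ 2 := by
  rw [lintegral_withDensity_eq_lintegral_mul _ hm (by fun_prop),
    lintegral_withDensity_eq_lintegral_mul _ hm (by fun_prop),
    withDensity_apply _ MeasurableSet.univ, setLIntegral_univ]
  refine midpointPrekopaLeindler_euclidean n _ _ _ (hm.mul (by fun_prop)) (hm.mul (by fun_prop))
    hm fun x y => ?_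
  by_cases hx : x ∈ K
  swap
  · simp [hx]
  by_cases hy : y ∈ K
  swap
  · simp [hy]
  have hmid : (2⁻¹ : ℝ) • (x + y) ∈ K := by
    rw [smul_add]
    exact hV.1 hx hy (by norm_num) (by norm_num) (by norm_num)
  -- At the midpoint strong convexity gains `α/8 ‖x - y‖²`; the square on `H` doubles it to the `α/4
  -- ‖x - y‖²` allowed to `u + v`.
  have hVm := hV.2 hx hy (by norm_num : (0 : ℝ) ≤ 2⁻¹)
    (by norm_num : (0 : ℝ) ≤ 2⁻¹) (by norm_num)
  rw [← smul_add] at hVm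
  simp only [smul_eq_mul] at hVm
  simp only [Pi.mul_apply, indicator_of_mem hx, indicator_of_mem hy, indicator_of_mem hmid]
  rw [← ENNReal.ofReal_pow (Real.exp_pos _).le, ← ENNReal.ofReal_mul (Real.exp_pos _).le,
    ← ENNReal.ofReal_mul (Real.exp_pos _).le, ← ENNReal.ofReal_mul (by positivity),
    ← Real.exp_add, ← Real.exp_add, ← Real.exp_add, ← Real.exp_nat_mul]
  refine ENNReal.ofReal_le_ofReal (Real.exp_le_exp.2 ?_)
  have := huv x y
  push_cast
  nlinarith

/-- The Poincaré inequality for a finite strongly log-concave measure and a test function. -/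
theorem integral_prod_sq_sub_le_of_strongConvexOn {n : ℕ} {K : Set (E n)} {V : E n → ℝ} {α : ℝ}
    (hα : 0 < α) (hV : StrongConvexOn K α V)
    (hm : Measurable (K.indicator fun x => ENNReal.ofReal (Real.exp (-V x))))
    {μ : Measure (E n)} [IsFiniteMeasure μ]
    (hμ : μ = volume.withDensity (K.indicator fun x => ENNReal.ofReal (Real.exp (-V x))))
    {g : E n → ℝ} (hg : ContDiff ℝ 2 g) (hgc : HasCompactSupport g) :
    ∫ p, (g p.1 - g p.2) ^ 2 ∂(μ.prod μ)
      ≤ 4 / α * (μ.real univ * ∫ x, ‖fderiv ℝ g x‖ ^ 2 ∂μ) := by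
  have hg' : ContDiff ℝ 1 (fderiv ℝ g) := hg.fderiv_right (by norm_num)
  obtain ⟨L, hL⟩ := hg'.lipschitzWith_of_hasCompactSupport (hgc.fderiv (𝕜 := ℝ)) one_ne_zero
  obtain ⟨B, hB⟩ := hgc.exists_bound_of_continuous hg.continuous
  obtain ⟨G, hG⟩ := (hgc.fderiv (𝕜 := ℝ)).exists_bound_of_continuous hg'.continuous
  have hgm : Measurable g := hg.continuous.measurable
  have hgm' : Measurable (fun x => ‖fderiv ℝ g x‖) := hg'.continuous.norm.measurable
  set q : E n → ℝ := fun x => 2 / α * ‖fderiv ℝ g x‖ ^ 2 with hq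
  have hqm : Measurable q := by fun_prop
  set A := 2 * B with hA
  set Q := 2 / α * G ^ 2 with hQ
  have q0 : ∀ x, 0 ≤ q x := fun x => by positivity
  have qQ : ∀ x, q x ≤ Q := fun x => by
    simp only [hq, hQ]
    gcongr
    exact hG x
  have gA : ∀ x y, |g x - g y| ≤ A := fun x y => by
    have := hB x; have := hB y
    rw [Real.norm_eq_abs] at *
    exact (abs_sub _ _).trans (by linarith)
  have hB0 : 0 ≤ B := (norm_nonneg _).trans (hB 0)
  have hQ0 : 0 ≤ Q := (q0 0).trans (qQ 0)
  set M := μ.real univ with hM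
  have hbd : ∀ {β : Type} [MeasurableSpace β] (ν : Measure β) [IsFiniteMeasure ν] (u : β → ℝ)
      (C : ℝ), Measurable u → (∀ x, |u x| ≤ C) → Integrable u ν := fun ν _ u C hu h =>
    Integrable.of_bound hu.aestronglyMeasurable C (ae_of_all _ h)
  -- Maurey's inequality with `u = εg - ε²q` and `v = -εg`. The allowance `α/4 r²` is split in
  -- halves: one pays for the gradient term by completing the square, which dictates `q =
  -- (2/α)‖∇g‖²`; the other pays for the Taylor error `εL r²`, whence the smallness condition on
  -- `ε`.
  have key : ∀ ε : ℝ, 0 < ε → 4 * ε * L ≤ α / 2 →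
      ∫ p, Real.exp (ε * (g p.1 - g p.2) - ε ^ 2 * q p.1) ∂(μ.prod μ) ≤ M ^ 2 := by
    intro ε hε hεL
    have h1 := lintegral_mul_lintegral_le_of_strongConvexOn hV hm
      (u := fun x => ε * g x - ε ^ 2 * q x) (v := fun y => -(ε * g y)) (by fun_prop) (by fun_prop)
      (fun x y => by
        have h2 := sub_le_norm_fderiv_mul_add_sq (hg.differentiable (by norm_num)) hL x y
        set r := ‖x - y‖
        set N := ‖fderiv ℝ g x‖
        have h3 : ε * (g x - g y) ≤ ε * (N * r + L * r ^ 2) := by gcongr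
        have h4 : ε * N * r ≤ ε ^ 2 * (2 / α * N ^ 2) + α / 8 * r ^ 2 := by
          have : 0 ≤ 2 / α * (ε * N - α / 4 * r) ^ 2 := by positivity
          have e : 2 / α * (ε * N - α / 4 * r) ^ 2
              = ε ^ 2 * (2 / α * N ^ 2) - ε * N * r + α / 8 * r ^ 2 := by
            field_simp; ring
          linarith
        have h5 : 4 * ε * L * r ^ 2 ≤ α / 2 * r ^ 2 := by gcongr
        simp only [hq]
        linarith)
    rw [← hμ] at h1
    have i1 : Integrable (fun x => Real.exp (ε * g x - ε ^ 2 * q x)) μ :=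
      hbd μ _ (Real.exp (ε * B)) (by fun_prop) fun x => by
        rw [Real.abs_exp, Real.exp_le_exp]
        have := (le_abs_self _).trans (hB x)
        have : ε * g x ≤ ε * B := by gcongr
        have : 0 ≤ ε ^ 2 * q x := mul_nonneg (by positivity) (q0 x)
        linarith
    have i2 : Integrable (fun x => Real.exp (-(ε * g x))) μ :=
      hbd μ _ (Real.exp (ε * B)) (by fun_prop) fun x => by
        rw [Real.abs_exp, Real.exp_le_exp, ← mul_neg]
        have := (neg_le_abs _).trans (hB x)
        gcongr
    rw [← ofReal_integral_eq_lintegral_ofReal i1 (ae_of_all _ fun _ => (Real.exp_pos _).le),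
      ← ofReal_integral_eq_lintegral_ofReal i2 (ae_of_all _ fun _ => (Real.exp_pos _).le),
      ← ENNReal.ofReal_mul (integral_nonneg fun _ => (Real.exp_pos _).le),
      ← integral_prod_mul] at h1
    have h6 := ENNReal.toReal_mono (by finiteness) h1
    rw [ENNReal.toReal_ofReal (by positivity), ENNReal.toReal_pow] at h6
    refine le_trans (le_of_eq ?_) h6
    congr 1 with p
    rw [← Real.exp_add]
    ring_nf
  have iΔ : Integrable (fun p : E n × E n => g p.1 - g p.2) (μ.prod μ) :=
    hbd _ _ A (by fun_prop) fun p => gA _ _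
  have iΔ2 : Integrable (fun p : E n × E n => (g p.1 - g p.2) ^ 2) (μ.prod μ) :=
    hbd _ _ (A ^ 2) (by fun_prop) fun p => by
      rw [abs_pow]; exact pow_le_pow_left₀ (abs_nonneg _) (gA _ _) 2
  have iq : Integrable (fun p : E n × E n => q p.1) (μ.prod μ) :=
    hbd _ _ Q (by fun_prop) fun p => by rw [abs_of_nonneg (q0 _)]; exact qQ _
  have ig : Integrable g μ := hbd _ _ B hgm hB
  have eΔ : ∫ p : E n × E n, (g p.1 - g p.2) ∂(μ.prod μ) = 0 := by
    rw [integral_sub (ig.comp_fst μ) (ig.comp_snd μ), integral_fun_fst, integral_fun_snd, sub_self]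
  have eq' : ∫ p : E n × E n, q p.1 ∂(μ.prod μ) = M * ∫ x, q x ∂μ := by
    rw [integral_fun_fst, smul_eq_mul]
  set R := A * Q + (A + Q) ^ 3 with hR
  -- In the expansion of `key` the constants cancel and the linear term vanishes by antisymmetry, so
  -- division by `ε²` leaves the desired difference up to `O(ε)`.
  have key2 : ∀ ε : ℝ, 0 < ε → ε ≤ 1 → ε * (A + Q) ≤ 1 → 4 * ε * L ≤ α / 2 →
      (∫ p : E n × E n, (g p.1 - g p.2) ^ 2 ∂(μ.prod μ)) / 2 - M * ∫ x, q x ∂μ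
        ≤ ε * (R * M ^ 2) := by
    intro ε hε hε1 hεS hεL
    have h1 := key ε hε hεL
    have i3 : Integrable (fun p : E n × E n =>
        Real.exp (ε * (g p.1 - g p.2) - ε ^ 2 * q p.1)) (μ.prod μ) :=
      hbd _ _ (Real.exp (ε * A)) (by fun_prop) fun p => by
        rw [Real.abs_exp, Real.exp_le_exp]
        have : ε * (g p.1 - g p.2) ≤ ε * A := by
          gcongr; exact (le_abs_self _).trans (gA _ _)
        have : 0 ≤ ε ^ 2 * q p.1 := mul_nonneg (by positivity) (q0 _)
        linarith
    have j1 := (integrable_const (μ := μ.prod μ) (1 : ℝ)).add (iΔ.const_mul ε)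
    have j2 := j1.sub (iq.const_mul (ε ^ 2))
    have j3 := j2.add ((iΔ2.const_mul (ε ^ 2)).div_const 2)
    have j4 := j3.sub (integrable_const (μ := μ.prod μ) (ε ^ 3 * R))
    have h2 := (integral_mono j4 i3 fun p =>
      exp_perturbation_lower_bound hε hε1 hεS (gA p.1 p.2) (q0 p.1) (qQ p.1)).trans h1
    simp only [Pi.add_def, Pi.sub_def] at h2 j1 j2 j3 j4
    rw [integral_sub j3 (integrable_const _),
      integral_add j2 ((iΔ2.const_mul (ε ^ 2)).div_const 2),
      integral_sub j1 (iq.const_mul (ε ^ 2)), integral_add (integrable_const _) (iΔ.const_mul ε),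
      integral_const_mul, integral_const_mul (ε ^ 2), integral_div, integral_const_mul (ε ^ 2), eΔ, eq',
      integral_const, integral_const, ← univ_prod_univ, measureReal_prod_prod] at h2
    simp only [smul_eq_mul, ← hM] at h2
    have h3 : ε ^ 2 * ((∫ p : E n × E n, (g p.1 - g p.2) ^ 2 ∂(μ.prod μ)) / 2
        - M * ∫ x, q x ∂μ) ≤ ε ^ 2 * (ε * (R * M ^ 2)) := by nlinarith
    exact le_of_mul_le_mul_left h3 (by positivity)
  have lim : (∫ p : E n × E n, (g p.1 - g p.2) ^ 2 ∂(μ.prod μ)) / 2 - M * ∫ x, q x ∂μ ≤ 0 := by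
    have t1 : Tendsto (fun ε : ℝ => ε * (R * M ^ 2)) (𝓝[>] 0) (𝓝 0) := by
      have : Tendsto (fun ε : ℝ => ε * (R * M ^ 2)) (𝓝 0) (𝓝 (0 * (R * M ^ 2))) :=
        tendsto_id.mul_const _
      rw [zero_mul] at this
      exact this.mono_left nhdsWithin_le_nhds
    have small : ∀ (f : ℝ → ℝ) (c : ℝ), Continuous f → f 0 < c → ∀ᶠ ε in 𝓝[>] (0 : ℝ), f ε ≤ c :=
      fun f c hf h0 => Eventually.mono
        (Filter.Eventually.filter_mono nhdsWithin_le_nhds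
          (hf.continuousAt.eventually_lt_const h0)) fun _ h => le_of_lt h
    refine ge_of_tendsto t1 ?_
    filter_upwards [self_mem_nhdsWithin, small (fun ε => ε) 1 (by fun_prop) (by norm_num),
      small (fun ε => ε * (A + Q)) 1 (by fun_prop) (by norm_num),
      small (fun ε => 4 * ε * L) (α / 2) (by fun_prop) (by simpa using by positivity)]
      with ε a b c d
    exact key2 ε a b c d
  have e : M * ∫ x, q x ∂μ = 2 / α * (M * ∫ x, ‖fderiv ℝ g x‖ ^ 2 ∂μ) := by
    simp only [hq]
    rw [integral_const_mul]; ring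
  rw [e] at lim
  have : 4 / α * (M * ∫ x, ‖fderiv ℝ g x‖ ^ 2 ∂μ)
      = 2 * (2 / α * (M * ∫ x, ‖fderiv ℝ g x‖ ^ 2 ∂μ)) := by ring
  linarith

theorem lintegral_lintegral_sq_sub_le_of_strongConvexOn {n : ℕ} {K : Set (E n)} {V : E n → ℝ}
    {α : ℝ} (hα : 0 < α) (hV : StrongConvexOn K α V)
    (hm : Measurable (K.indicator fun x => ENNReal.ofReal (Real.exp (-V x))))
    {μ : Measure (E n)} [IsFiniteMeasure μ]
    (hμ : μ = volume.withDensity (K.indicator fun x => ENNReal.ofReal (Real.exp (-V x))))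
    {g : E n → ℝ} (hg : ContDiff ℝ 2 g) (hgc : HasCompactSupport g) :
    ∫⁻ x, ∫⁻ y, ‖g x - g y‖ₑ ^ 2 ∂μ ∂μ
      ≤ ENNReal.ofReal (4 / α) * (μ univ * ∫⁻ x, ‖fderiv ℝ g x‖ₑ ^ 2 ∂μ) := by
  have h := integral_prod_sq_sub_le_of_strongConvexOn hα hV hm hμ hg hgc
  have hg' : Continuous (fderiv ℝ g) := hg.continuous_fderiv (by norm_num)
  obtain ⟨B, hB⟩ := hgc.exists_bound_of_continuous hg.continuous
  obtain ⟨G, hG⟩ := (hgc.fderiv (𝕜 := ℝ)).exists_bound_of_continuous hg'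
  have hgm := hg.continuous
  have i1 : Integrable (fun p : E n × E n => (g p.1 - g p.2) ^ 2) (μ.prod μ) :=
    Integrable.of_bound (by fun_prop) ((B + B) ^ 2) (ae_of_all _ fun p => by
      rw [norm_pow]
      exact pow_le_pow_left₀ (norm_nonneg _)
        ((norm_sub_le _ _).trans (add_le_add (hB _) (hB _))) 2)
  have i2 : Integrable (fun x => ‖fderiv ℝ g x‖ ^ 2) μ :=
    Integrable.of_bound (by fun_prop) (G ^ 2) (ae_of_all _ fun x => by
      rw [norm_pow, norm_norm]
      exact pow_le_pow_left₀ (norm_nonneg _) (hG x) 2)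
  have h2 := ENNReal.ofReal_le_ofReal h
  rw [ENNReal.ofReal_mul (by positivity), ENNReal.ofReal_mul (by positivity),
    ofReal_measureReal, ofReal_integral_eq_lintegral_ofReal i1 (ae_of_all _ fun _ => sq_nonneg _),
    ofReal_integral_eq_lintegral_ofReal i2 (ae_of_all _ fun _ => sq_nonneg _),
    lintegral_prod _ (by fun_prop)] at h2
  have e : ∀ t : ℝ, ENNReal.ofReal (t ^ 2) = ‖t‖ₑ ^ 2 := fun t => by
    rw [← sq_abs, ENNReal.ofReal_pow (abs_nonneg _), Real.enorm_eq_ofReal_abs]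
  simpa only [e, enorm_norm] using h2

/-! ### Poincaré for differentiable functions on open convex sets. -/

theorem sq_lintegral_le_lintegral_sq {β : Type*} [MeasurableSpace β] (ν : Measure β)
    [IsProbabilityMeasure ν] {b : β → ℝ≥0∞} (hb : AEMeasurable b ν) :
    (∫⁻ x, b x ∂ν) ^ 2 ≤ ∫⁻ x, b x ^ 2 ∂ν := by
  have h := ENNReal.lintegral_mul_le_Lp_mul_Lq ν Real.HolderConjugate.two_two hb
    (aemeasurable_const (b := (1 : ℝ≥0∞)))
  simp only [Pi.mul_apply, mul_one, lintegral_const, measure_univ,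
    ENNReal.rpow_ofNat, one_pow,
    ENNReal.one_rpow] at h
  calc (∫⁻ x, b x ∂ν) ^ 2 ≤ ((∫⁻ x, b x ^ 2 ∂ν) ^ (1 / 2 : ℝ)) ^ 2 := pow_le_pow_left' h 2
    _ = ∫⁻ x, b x ^ 2 ∂ν := by
      rw [← ENNReal.rpow_natCast, ← ENNReal.rpow_mul]; simp

/-- Integration by parts moves the derivative from `φ` to `F`. Differentiability is needed only
where `φ (x - ·)` is supported, so `F` may be a cut-off function with jumps elsewhere. -/
theorem fderiv_convolution_eq_integral {n : ℕ} {φ F : E n → ℝ} {F' : E n → (E n →L[ℝ] ℝ)}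
    (hφ : ContDiff ℝ 1 φ) (hφc : HasCompactSupport φ) (hF : Integrable F) (hF' : Integrable F')
    (x : E n) (hd : ∀ u, x - u ∈ tsupport φ → HasFDerivAt F (F' u) u) :
    fderiv ℝ (φ ⋆[ContinuousLinearMap.lsmul ℝ ℝ] F) x = ∫ u, φ (x - u) • F' u := by
  have h1 := (hφc.hasFDerivAt_convolution_left (ContinuousLinearMap.lsmul ℝ ℝ) hφ
    hF.locallyIntegrable x).fderiv
  rw [h1, convolution_eq_swap]
  have hcont : Continuous φ := hφ.continuous
  have hcont' : Continuous (fderiv ℝ φ) := hφ.continuous_fderiv (by norm_num)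
  obtain ⟨B, hB⟩ := hφc.exists_bound_of_continuous hcont
  obtain ⟨B', hB'⟩ := (hφc.fderiv (𝕜 := ℝ)).exists_bound_of_continuous hcont'
  have i1 := (HasCompactSupport.convolutionExists_left
    ((ContinuousLinearMap.lsmul ℝ ℝ : ℝ →L[ℝ] ℝ →L[ℝ] ℝ).precompL (E n))
    (hφc.fderiv (𝕜 := ℝ)) hcont' hF.locallyIntegrable x).integrable_swap
  have i2 : Integrable fun u => φ (x - u) • F' u :=
    hF'.bdd_smul B (by fun_prop) (ae_of_all _ fun u => hB _)
  ext v
  rw [ContinuousLinearMap.integral_apply i1, ContinuousLinearMap.integral_apply i2]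
  simp only [ContinuousLinearMap.precompL_apply, ContinuousLinearMap.lsmul_apply, smul_eq_mul,
    smul_apply]
  have hF'v : Integrable fun u => F' u v := hF'.apply_continuousLinearMap v
  have hsupp : ∀ u ∈ tsupport (fun u => φ (x - u)), x - u ∈ tsupport φ := by
    intro u hu
    have := tsupport_comp_subset_preimage φ (f := fun u => x - u) (by fun_prop) hu
    exact this
  have h2 := integral_bilinear_hasLineDerivAt_right_eq_neg_left_of_integrable
    (μ := (volume : Measure (E n))) (f := F) (f' := fun u => F' u v)
    (g := fun u => φ (x - u)) (g' := fun u => -(fderiv ℝ φ (x - u) v)) (v := v)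
    (B := ContinuousLinearMap.mul ℝ ℝ)
    (by
      simp only [ContinuousLinearMap.mul_apply']
      exact hF'v.mul_bdd (c := B) (by fun_prop) (ae_of_all _ fun u => hB _))
    (by
      simp only [ContinuousLinearMap.mul_apply']
      refine hF.mul_bdd (c := B' * ‖v‖) (Continuous.aestronglyMeasurable (by fun_prop)) (ae_of_all _ fun u => ?_)
      rw [norm_neg]
      exact ((fderiv ℝ φ (x - u)).le_opNorm v).trans (by gcongr; exact hB' _))
    (by
      simp only [ContinuousLinearMap.mul_apply']
      exact hF.mul_bdd (c := B) (by fun_prop) (ae_of_all _ fun u => hB _))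
    (fun u hu => (hd u (hsupp u hu)).hasLineDerivAt v)
    (fun u _ => by
      have h3 : HasFDerivAt (fun u => φ (x - u)) (-(fderiv ℝ φ (x - u))) u := by
        have h4 := ((hφ.differentiable (by norm_num)) (x - u)).hasFDerivAt.comp u
          ((hasFDerivAt_id u).const_sub x)
        have e : -(fderiv ℝ φ (x - u))
            = (fderiv ℝ φ (x - u)).comp (-ContinuousLinearMap.id ℝ (E n)) := by ext; simp
        rw [e]
        exact h4
      simpa using h3.hasLineDerivAt v)
  simp only [ContinuousLinearMap.mul_apply'] at h2
  have h5 : ∫ u, fderiv ℝ φ (x - u) v * F u = -∫ u, F u * -(fderiv ℝ φ (x - u) v) := by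
    rw [← integral_neg]; congr 1 with u; ring
  rw [h5, h2, neg_neg]
  congr 1 with u; ring

/-- Jensen's inequality for the probability density `u ↦ φ (x - u)`. -/
theorem enorm_fderiv_convolution_sq_le {n : ℕ} (φ : ContDiffBump (0 : E n)) {F : E n → ℝ}
    {F' : E n → (E n →L[ℝ] ℝ)} (hF : Integrable F) (hF' : Integrable F') (x : E n)
    (hd : ∀ u, ‖x - u‖ ≤ φ.rOut → HasFDerivAt F (F' u) u) :
    ‖fderiv ℝ (φ.normed volume ⋆[ContinuousLinearMap.lsmul ℝ ℝ] F) x‖ₑ ^ 2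
      ≤ ∫⁻ u, ENNReal.ofReal (φ.normed volume (x - u)) * ‖F' u‖ₑ ^ 2 := by
  have hc : Continuous (φ.normed volume) := φ.continuous_normed
  rw [fderiv_convolution_eq_integral (F' := F') φ.contDiff_normed φ.hasCompactSupport_normed hF hF'
    x (fun u hu => hd u (by
      rw [φ.tsupport_normed_eq, mem_closedBall_zero_iff] at hu; exact hu))]
  set ν := (volume : Measure (E n)).withDensity
    fun u => ENNReal.ofReal (φ.normed volume (x - u)) with hν
  have hone : ∫⁻ u, ENNReal.ofReal (φ.normed volume (x - u)) = 1 := by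
    rw [lintegral_sub_left_eq_self (fun u => ENNReal.ofReal (φ.normed volume u)) x,
      ← ofReal_integral_eq_lintegral_ofReal φ.integrable_normed
        (ae_of_all _ fun u => φ.nonneg_normed u), φ.integral_normed, ofReal_one]
  have : IsProbabilityMeasure ν := ⟨by
    rw [hν, withDensity_apply _ MeasurableSet.univ, setLIntegral_univ, hone]⟩
  have hac : ν ≪ volume := withDensity_absolutelyContinuous _ _
  have hm : Measurable fun u => ENNReal.ofReal (φ.normed volume (x - u)) := by fun_prop
  have h1 := sq_lintegral_le_lintegral_sq ν (hF'.aestronglyMeasurable.enorm.mono_ac hac)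
  rw [lintegral_withDensity_eq_lintegral_mul₀ hm.aemeasurable hF'.aestronglyMeasurable.enorm,
    lintegral_withDensity_eq_lintegral_mul₀ hm.aemeasurable
      (hF'.aestronglyMeasurable.enorm.pow_const 2)] at h1
  refine le_trans (pow_le_pow_left' ?_ 2) h1
  refine (enorm_integral_le_lintegral_enorm _).trans (le_of_eq (lintegral_congr fun u => ?_))
  rw [enorm_smul, Real.enorm_of_nonneg (φ.nonneg_normed _)]
  rfl

/-- The measure `e^{-V} dx` on `K`. -/
def gibbsMeasure {n : ℕ} (K : Set (E n)) (V : E n → ℝ) : Measure (E n) :=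
  volume.withDensity (K.indicator fun x => ENNReal.ofReal (Real.exp (-V x)))

theorem gibbsMeasure_ae_mem {n : ℕ} {K : Set (E n)} {V : E n → ℝ}
    (hm : Measurable (K.indicator fun x => ENNReal.ofReal (Real.exp (-V x)))) :
    ∀ᵐ x ∂(gibbsMeasure K V), x ∈ K := by
  rw [gibbsMeasure, ae_withDensity_iff hm]
  exact ae_of_all _ fun x hx => by_contra fun h => hx (indicator_of_notMem h _)

/-- The bounded ratio of outer to inner radius gives almost everywhere convergence of mollifications
of a merely integrable function. -/
theorem exists_contDiffBump_seq (n : ℕ) {r : ℝ} (hr : 0 < r) :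
    ∃ φ : ℕ → ContDiffBump (0 : E n), (∀ j, (φ j).rOut < r) ∧
      (∀ j, (φ j).rOut ≤ 2 * (φ j).rIn) ∧ Tendsto (fun j => (φ j).rOut) atTop (𝓝 0) := by
  have hp : ∀ j : ℕ, 0 < r / (j + 2) := fun j => by positivity
  refine ⟨fun j => ⟨r / (j + 2) / 2, r / (j + 2), half_pos (hp j), half_lt_self (hp j)⟩,
    fun j => ?_, fun j => ?_, ?_⟩
  · show r / (j + 2) < r
    rw [div_lt_iff₀ (by positivity)]
    have : (0 : ℝ) ≤ j := j.cast_nonneg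
    nlinarith
  · show r / (j + 2) ≤ 2 * (r / (j + 2) / 2)
    linarith
  · show Tendsto (fun j : ℕ => r / ((j : ℝ) + 2)) atTop (𝓝 0)
    exact Tendsto.div_atTop tendsto_const_nhds
      (tendsto_atTop_add_const_right _ _ tendsto_natCast_atTop_atTop)

theorem lintegral_lintegral_sq_sub_le_of_cthickening {n : ℕ} {K : Set (E n)} {V : E n → ℝ}
    {α B r : ℝ} (hα : 0 < α) (hV : StrongConvexOn K α V) (hK : MeasurableSet K)
    (hKb : Bornology.IsBounded K) (hr : 0 < r)
    (hm : Measurable (K.indicator fun x => Real.exp (-V x)))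
    (hB : ∀ x ∈ K, Real.exp (-V x) ≤ B) {f : E n → ℝ} (hf : Measurable f)
    (hfd : ∀ x ∈ Metric.cthickening r K, DifferentiableAt ℝ f x)
    (hfin : ∫⁻ x in Metric.cthickening r K, ‖fderiv ℝ f x‖ₑ ^ 2 ≠ ∞) :
    ∫⁻ x, ∫⁻ y, ‖f x - f y‖ₑ ^ 2 ∂(gibbsMeasure K V) ∂(gibbsMeasure K V)
      ≤ ENNReal.ofReal (4 / α) *
        (gibbsMeasure K V univ * ∫⁻ x, ‖fderiv ℝ f x‖ₑ ^ 2 ∂(gibbsMeasure K V)) := by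
  set K' := Metric.cthickening r K with hK'
  have hcK' : IsCompact K' :=
    Metric.isCompact_of_isClosed_isBounded Metric.isClosed_cthickening hKb.cthickening
  have hmK' : MeasurableSet K' := hcK'.measurableSet
  have hKK' : K ⊆ K' := Metric.self_subset_cthickening K
  set w : E n → ℝ := K.indicator fun x => Real.exp (-V x) with hw
  have hwe : (K.indicator fun x => ENNReal.ofReal (Real.exp (-V x)))
      = fun x => ENNReal.ofReal (w x) := by
    ext x
    by_cases hx : x ∈ K <;> simp [hw, hx]
  have hm' : Measurable (K.indicator fun x => ENNReal.ofReal (Real.exp (-V x))) := by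
    rw [hwe]; fun_prop
  have hw0 : ∀ x, 0 ≤ w x := fun x => indicator_nonneg (fun _ _ => (Real.exp_pos _).le) x
  have hwB : ∀ x, w x ≤ max B 0 := fun x => by
    by_cases hx : x ∈ K
    · simp only [hw, indicator_of_mem hx]; exact (hB x hx).trans (le_max_left _ _)
    · simp [hw, hx]
  have hwi : Integrable w := by
    rw [hw, integrable_indicator_iff hK]
    refine IntegrableOn.of_bound (hKb.measure_lt_top) ?_ B ?_
    · exact (hm.aestronglyMeasurable.restrict (s := K)).congr
        (indicator_ae_eq_restrict hK)
    · exact ae_restrict_of_forall_mem hK fun x hx => by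
        rw [Real.norm_of_nonneg (Real.exp_pos _).le]; exact hB x hx
  set μ := gibbsMeasure K V with hμ
  have hμw : μ = volume.withDensity fun x => ENNReal.ofReal (w x) := by
    rw [hμ, gibbsMeasure, hwe]
  have hμfin : IsFiniteMeasure μ := by
    rw [hμw]
    refine isFiniteMeasure_withDensity ?_
    rw [← ofReal_integral_eq_lintegral_ofReal hwi (ae_of_all _ hw0)]
    exact ofReal_ne_top
  -- The cut-off may jump at the boundary of `K'`, but mollifiers of radius below `r` do not see
  -- this from points of `K`.
  set F := K'.indicator f with hF
  set F' := K'.indicator (fderiv ℝ f) with hF'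
  have hFi : Integrable F := by
    rw [hF, integrable_indicator_iff hmK']
    exact ContinuousOn.integrableOn_compact hcK'
      fun x hx => (hfd x hx).continuousAt.continuousWithinAt
  have hF'i : Integrable F' := by
    refine IntegrableOn.integrable_indicator (f := fderiv ℝ f) ?_ hmK'
    have : IsFiniteMeasure ((volume : Measure (E n)).restrict K') :=
      ⟨by rw [Measure.restrict_apply_univ]; exact hcK'.measure_lt_top⟩
    have hmem : MemLp (fderiv ℝ f) 2 (volume.restrict K') := by
      refine ⟨(measurable_fderiv ℝ f).aestronglyMeasurable, ?_⟩
      rw [eLpNorm_lt_top_iff_lintegral_rpow_enorm_lt_top two_ne_zero ofNat_ne_top]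
      simpa using hfin.lt_top
    exact hmem.integrable one_le_two
  have hF'2 : ∫⁻ u, ‖F' u‖ₑ ^ 2 ≠ ∞ := by
    have : (fun u => ‖F' u‖ₑ ^ 2) = K'.indicator fun u => ‖fderiv ℝ f u‖ₑ ^ 2 := by
      ext u
      by_cases hu : u ∈ K'
      · simp [hF', hu]
      · have h0 : F' u = 0 := indicator_of_notMem hu _
        have h1 : ‖(0 : E n →L[ℝ] ℝ)‖ₑ = 0 := by rw [← ofReal_norm, norm_zero, ofReal_zero]
        rw [h0, h1, indicator_of_notMem hu, zero_pow two_ne_zero]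
    rw [this, lintegral_indicator hmK']
    exact hfin
  have hball : ∀ x ∈ K, ∀ u, ‖x - u‖ < r → u ∈ K' ∧ F =ᶠ[𝓝 u] f := by
    intro x hx u hu
    have hsub : Metric.ball x r ⊆ K' :=
      (Metric.ball_subset_thickening hx r).trans (Metric.thickening_subset_cthickening r K)
    have hu' : u ∈ Metric.ball x r := by rwa [mem_ball_iff_norm, norm_sub_rev]
    refine ⟨hsub hu', ?_⟩
    filter_upwards [Metric.isOpen_ball.mem_nhds hu'] with z hz
    exact indicator_of_mem (hsub hz) f
  obtain ⟨φ, hφr, hφ2, hφ0⟩ := exists_contDiffBump_seq n hr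
  set G : ℕ → E n → ℝ := fun j =>
    (φ j).normed volume ⋆[ContinuousLinearMap.lsmul ℝ ℝ] F with hG
  have hGs : ∀ j, ContDiff ℝ 2 (G j) := fun j =>
    (φ j).hasCompactSupport_normed.contDiff_convolution_left (n := 2) _ (φ j).contDiff_normed
      hFi.locallyIntegrable
  have hGc : ∀ j, HasCompactSupport (G j) := fun j =>
    HasCompactSupport.convolution _ (φ j).hasCompactSupport_normed
      (HasCompactSupport.intro hcK' fun x hx => indicator_of_notMem hx f)
  have hGt : ∀ x ∈ K, Tendsto (fun j => G j x) atTop (𝓝 (f x)) := by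
    intro x hx
    refine ContDiffBump.convolution_tendsto_right (g := fun _ => F) (k := fun _ => x) hφ0
      (Eventually.of_forall fun _ => hFi.aestronglyMeasurable) ?_ tendsto_const_nhds
    have hc := (hfd x (hKK' hx)).continuousAt.tendsto
    have hev := (hball x hx x (by simpa using hr)).2
    exact (hc.congr' hev.symm).comp tendsto_snd
  have hae : ∀ᵐ x ∂μ, x ∈ K := gibbsMeasure_ae_mem hm'
  -- Jensen and Tonelli transfer the mollifier from the gradient, which is only square integrable,
  -- to the weight, which is bounded. In the limit the right side converges by dominated
  -- convergence, and the left side is handled by Fatou.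
  have step : ∀ j, ∫⁻ p : E n × E n, ‖G j p.1 - G j p.2‖ₑ ^ 2 ∂(μ.prod μ)
      ≤ ENNReal.ofReal (4 / α) * (μ univ * ∫⁻ u, ‖F' u‖ₑ ^ 2 *
        ENNReal.ofReal (((φ j).normed volume ⋆[ContinuousLinearMap.lsmul ℝ ℝ] w) u)) := by
    intro j
    have hGcont := (hGs j).continuous
    have hφc : Continuous ((φ j).normed volume) := (φ j).continuous_normed
    rw [lintegral_prod _ (by fun_prop)]
    refine (lintegral_lintegral_sq_sub_le_of_strongConvexOn hα hV hm' hμ (hGs j) (hGc j)).trans ?_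
    refine mul_le_mul' le_rfl (mul_le_mul' le_rfl ?_)
    calc ∫⁻ x, ‖fderiv ℝ (G j) x‖ₑ ^ 2 ∂μ
        ≤ ∫⁻ x, (∫⁻ u, ENNReal.ofReal ((φ j).normed volume (x - u)) * ‖F' u‖ₑ ^ 2) ∂μ := by
          refine lintegral_mono_ae ?_
          filter_upwards [hae] with x hx
          refine enorm_fderiv_convolution_sq_le (φ j) hFi hF'i x fun u hu => ?_
          obtain ⟨h1, h2⟩ := hball x hx u (hu.trans_lt (hφr j))
          have h3 : F' u = fderiv ℝ f u := indicator_of_mem h1 _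
          rw [h3]
          exact (hfd u h1).hasFDerivAt.congr_of_eventuallyEq h2
      _ = ∫⁻ u, ∫⁻ x, ENNReal.ofReal ((φ j).normed volume (x - u)) * ‖F' u‖ₑ ^ 2 ∂μ := by
          refine lintegral_lintegral_swap ?_
          have hF'm : Measurable F' := (measurable_fderiv ℝ f).indicator hmK'
          fun_prop
      _ = ∫⁻ u, ‖F' u‖ₑ ^ 2 *
            ENNReal.ofReal (((φ j).normed volume ⋆[ContinuousLinearMap.lsmul ℝ ℝ] w) u) := by
          refine lintegral_congr fun u => ?_
          rw [lintegral_mul_const _ (by fun_prop), mul_comm, hμw,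
            lintegral_withDensity_eq_lintegral_mul _ (by fun_prop) (by fun_prop),
            convolution_lsmul_swap, ofReal_integral_eq_lintegral_ofReal]
          · congr 1
            refine lintegral_congr fun x => ?_
            simp only [Pi.mul_apply, smul_eq_mul]
            rw [ENNReal.ofReal_mul ((φ j).nonneg_normed _), mul_comm,
              ← (φ j).normed_neg (u - x), neg_sub]
          · obtain ⟨C, hC⟩ := (φ j).hasCompactSupport_normed.exists_bound_of_continuous hφc
            exact hwi.bdd_smul C (by fun_prop) (ae_of_all _ fun x => hC _)
          · exact ae_of_all _ fun x => smul_nonneg ((φ j).nonneg_normed _) (hw0 _)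
  have hlim : Tendsto (fun j => ∫⁻ u, ‖F' u‖ₑ ^ 2 *
      ENNReal.ofReal (((φ j).normed volume ⋆[ContinuousLinearMap.lsmul ℝ ℝ] w) u)) atTop
      (𝓝 (∫⁻ u, ‖F' u‖ₑ ^ 2 * ENNReal.ofReal (w u))) := by
    have hF'm : Measurable F' := (measurable_fderiv ℝ f).indicator hmK'
    refine tendsto_lintegral_of_dominated_convergence
      (fun u => ‖F' u‖ₑ ^ 2 * ENNReal.ofReal (max B 0)) (fun j => ?_) (fun j => ?_) ?_ ?_
    · have : Continuous ((φ j).normed volume ⋆[ContinuousLinearMap.lsmul ℝ ℝ] w) :=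
        ((φ j).hasCompactSupport_normed.contDiff_convolution_left (n := 0) _
          (φ j).contDiff_normed hwi.locallyIntegrable).continuous
      have := this.measurable
      fun_prop
    · refine ae_of_all _ fun u => ?_
      have hφc : Continuous ((φ j).normed volume) := (φ j).continuous_normed
      refine mul_le_mul' le_rfl (ENNReal.ofReal_le_ofReal ?_)
      rw [convolution_lsmul_swap]
      have hone : ∫ x, (φ j).normed volume (u - x) * max B 0 = max B 0 := by
        rw [integral_mul_const, integral_sub_left_eq_self (fun x => (φ j).normed volume x)
          volume u, (φ j).integral_normed, one_mul]
      rw [← hone]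
      have hi : Integrable fun x => (φ j).normed volume (u - x) :=
        (φ j).integrable_normed.comp_sub_left u
      refine integral_mono_of_nonneg
        (ae_of_all _ fun x => smul_nonneg ((φ j).nonneg_normed _) (hw0 _))
        (hi.mul_const _) (ae_of_all _ fun x => ?_)
      exact mul_le_mul_of_nonneg_left (hwB x) ((φ j).nonneg_normed _)
    · rw [lintegral_mul_const _ (by fun_prop)]
      exact ENNReal.mul_ne_top hF'2 ofReal_ne_top
    · filter_upwards [ContDiffBump.ae_convolution_tendsto_right_of_locallyIntegrable hφ0
        (Eventually.of_forall hφ2) hwi.locallyIntegrable] with u hu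
      have hne : ‖F' u‖ₑ ^ 2 ≠ ∞ := by finiteness
      exact ENNReal.Tendsto.const_mul ((ENNReal.continuous_ofReal.tendsto _).comp hu)
        (Or.inr hne)
  have hend : ∫⁻ u, ‖F' u‖ₑ ^ 2 * ENNReal.ofReal (w u) = ∫⁻ x, ‖fderiv ℝ f x‖ₑ ^ 2 ∂μ := by
    have := measurable_fderiv ℝ f
    rw [hμw, lintegral_withDensity_eq_lintegral_mul _ (by fun_prop) (by fun_prop)]
    refine lintegral_congr fun u => ?_
    by_cases hu : u ∈ K
    · simp [hF', hKK' hu, mul_comm]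
    · simp [hw, hu]
  rw [hend] at hlim
  have hlim2 := ENNReal.Tendsto.const_mul (a := ENNReal.ofReal (4 / α))
    (ENNReal.Tendsto.const_mul (a := μ univ) hlim (Or.inr (measure_ne_top μ _)))
    (Or.inr ofReal_ne_top)
  rw [← lintegral_prod (fun p : E n × E n => ‖f p.1 - f p.2‖ₑ ^ 2) (by fun_prop)]
  calc ∫⁻ p : E n × E n, ‖f p.1 - f p.2‖ₑ ^ 2 ∂(μ.prod μ)
      = ∫⁻ p : E n × E n, liminf (fun j => ‖G j p.1 - G j p.2‖ₑ ^ 2) atTop ∂(μ.prod μ) := by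
        refine lintegral_congr_ae ?_
        have h1 : ∀ᵐ p : E n × E n ∂(μ.prod μ), p.1 ∈ K := Measure.quasiMeasurePreserving_fst.ae hae
        have h2 : ∀ᵐ p : E n × E n ∂(μ.prod μ), p.2 ∈ K := Measure.quasiMeasurePreserving_snd.ae hae
        filter_upwards [h1, h2] with p hp1 hp2
        have ht := (hGt _ hp1).sub (hGt _ hp2)
        have hc : Continuous fun t : ℝ => ‖t‖ₑ ^ 2 := by fun_prop
        exact ((hc.tendsto _).comp ht).liminf_eq.symm
    _ ≤ liminf (fun j => ∫⁻ p : E n × E n, ‖G j p.1 - G j p.2‖ₑ ^ 2 ∂(μ.prod μ)) atTop :=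
        lintegral_liminf_le fun j => by
          have := (hGs j).continuous
          fun_prop
    _ ≤ liminf (fun j => ENNReal.ofReal (4 / α) * (μ univ * ∫⁻ u, ‖F' u‖ₑ ^ 2 *
          ENNReal.ofReal (((φ j).normed volume ⋆[ContinuousLinearMap.lsmul ℝ ℝ] w) u))) atTop :=
        liminf_le_liminf (Eventually.of_forall step)
    _ = _ := hlim2.liminf_eq

theorem gibbsMeasure_eq_withDensity_restrict {n : ℕ} {K : Set (E n)} (hK : MeasurableSet K)
    (V : E n → ℝ) : gibbsMeasure K V =
      (volume.restrict K).withDensity fun x => ENNReal.ofReal (Real.exp (-V x)) :=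
  withDensity_indicator hK _

theorem gibbsMeasure_eq_restrict {n : ℕ} {K Ω : Set (E n)} (hK : MeasurableSet K)
    (hΩ : MeasurableSet Ω) (hKΩ : K ⊆ Ω) (V : E n → ℝ) :
    gibbsMeasure K V = (gibbsMeasure Ω V).restrict K := by
  rw [gibbsMeasure_eq_withDensity_restrict hK, gibbsMeasure_eq_withDensity_restrict hΩ,
    restrict_withDensity hK, Measure.restrict_restrict hK, inter_eq_self_of_subset_left hKΩ]

theorem measurable_indicator_of_continuousOn {n : ℕ} {K : Set (E n)} (hK : MeasurableSet K)
    {u : E n → ℝ} (hu : ContinuousOn u K) : Measurable (K.indicator u) := by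
  classical
  rw [← piecewise_eq_indicator]
  exact hu.measurable_piecewise continuousOn_const hK

theorem StrongConvexOn.subset {n : ℕ} {K Ω : Set (E n)} {V : E n → ℝ} {α : ℝ}
    (hV : StrongConvexOn Ω α V) (hK : Convex ℝ K) (hKΩ : K ⊆ Ω) : StrongConvexOn K α V :=
  ⟨hK, fun _ hx _ hy => hV.2 (hKΩ hx) (hKΩ hy)⟩

theorem lintegral_lintegral_sq_sub_le_of_cthickening_subset {n : ℕ} {Ω K : Set (E n)} {V : E n → ℝ}
    {α r : ℝ} (hα : 0 < α) (hV : StrongConvexOn Ω α V) (hΩ : IsOpen Ω) (hK : MeasurableSet K)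
    (hKc : Convex ℝ K) (hKb : Bornology.IsBounded K) (hr : 0 < r)
    (hKΩ : Metric.cthickening r K ⊆ Ω) {f : E n → ℝ} (hf : Measurable f)
    (hfd : ∀ x ∈ Ω, DifferentiableAt ℝ f x)
    (hfin : ∫⁻ x, ‖fderiv ℝ f x‖ₑ ^ 2 ∂(gibbsMeasure Ω V) ≠ ∞) :
    ∫⁻ x, ∫⁻ y, ‖f x - f y‖ₑ ^ 2 ∂(gibbsMeasure K V) ∂(gibbsMeasure K V)
      ≤ ENNReal.ofReal (4 / α) *
        (gibbsMeasure Ω V univ * ∫⁻ x, ‖fderiv ℝ f x‖ₑ ^ 2 ∂(gibbsMeasure Ω V)) := by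
  set K' := Metric.cthickening r K with hK'
  have hcK' : IsCompact K' :=
    Metric.isCompact_of_isClosed_isBounded Metric.isClosed_cthickening hKb.cthickening
  have hmK' : MeasurableSet K' := hcK'.measurableSet
  have hKK' : K ⊆ K' := Metric.self_subset_cthickening K
  have hVcont : ContinuousOn V Ω := by
    have := (hV.convexOn fun r => by positivity).continuousOn_interior
    rwa [hΩ.interior_eq] at this
  have hec : ContinuousOn (fun x => Real.exp (-V x)) Ω := by fun_prop
  obtain ⟨B, hB⟩ := hcK'.exists_bound_of_continuousOn (hec.mono hKΩ)
  obtain ⟨M, hM⟩ := hcK'.exists_bound_of_continuousOn (hVcont.mono hKΩ)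
  have hle : gibbsMeasure K V ≤ gibbsMeasure Ω V := by
    rw [gibbsMeasure_eq_restrict hK hΩ.measurableSet (hKK'.trans hKΩ)]
    exact Measure.restrict_le_self
  refine (lintegral_lintegral_sq_sub_le_of_cthickening (B := B) hα
    (StrongConvexOn.subset hV hKc (hKK'.trans hKΩ)) hK hKb hr
    (measurable_indicator_of_continuousOn hK (hec.mono (hKK'.trans hKΩ)))
    (fun x hx => (le_abs_self _).trans (hB x (hKK' hx))) hf (fun x hx => hfd x (hKΩ hx)) ?_).trans
    (mul_le_mul' le_rfl (mul_le_mul' (hle univ) (lintegral_mono' hle le_rfl)))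
  have hw : AEMeasurable (fun x => ENNReal.ofReal (Real.exp (-V x))) (volume.restrict Ω) :=
    (hec.aemeasurable hΩ.measurableSet).ennreal_ofReal
  have hg : Measurable fun x => ‖fderiv ℝ f x‖ₑ ^ 2 := (measurable_fderiv ℝ f).enorm.pow_const 2
  rw [gibbsMeasure_eq_withDensity_restrict hΩ.measurableSet,
    lintegral_withDensity_eq_lintegral_mul₀ hw hg.aemeasurable] at hfin
  -- On the compact thickening `V ≤ M`, so `exp M * exp (-V) ≥ 1` and the weighted gradient integral
  -- controls the unweighted one.
  refine ne_top_of_le_ne_top (ENNReal.mul_ne_top (a := ENNReal.ofReal (Real.exp M))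
    ofReal_ne_top hfin) ?_
  rw [← lintegral_const_mul' _ _ ofReal_ne_top]
  refine (setLIntegral_mono' hmK' fun x hx => ?_).trans (lintegral_mono_set hKΩ)
  rw [Pi.mul_apply, ← mul_assoc, ← ENNReal.ofReal_mul (Real.exp_pos _).le, ← Real.exp_add]
  refine le_mul_of_one_le_left zero_le ?_
  rw [ENNReal.one_le_ofReal, Real.one_le_exp_iff]
  have := (le_abs_self _).trans (hM x hx)
  linarith

/-- The Poincaré inequality for a strongly log-concave measure on an open convex set. -/
theorem lintegral_lintegral_sq_sub_le_of_isOpen {n : ℕ} {Ω : Set (E n)} {V : E n → ℝ}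
    {α : ℝ} (hα : 0 < α) (hV : StrongConvexOn Ω α V) (hΩ : IsOpen Ω) {f : E n → ℝ}
    (hf : Measurable f) (hfd : ∀ x ∈ Ω, DifferentiableAt ℝ f x) :
    ∫⁻ x, ∫⁻ y, ‖f x - f y‖ₑ ^ 2 ∂(gibbsMeasure Ω V) ∂(gibbsMeasure Ω V)
      ≤ ENNReal.ofReal (4 / α) *
        (gibbsMeasure Ω V univ * ∫⁻ x, ‖fderiv ℝ f x‖ₑ ^ 2 ∂(gibbsMeasure Ω V)) := by
  set μ := gibbsMeasure Ω V with hμ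
  rcases eq_or_ne (μ univ) 0 with h0 | h0
  · have : μ = 0 := Measure.measure_univ_eq_zero.1 h0
    simp [this]
  rcases eq_or_ne (∫⁻ x, ‖fderiv ℝ f x‖ₑ ^ 2 ∂μ) ∞ with hi | hi
  · rw [hi, ENNReal.mul_top h0, ENNReal.mul_top (by simpa using by positivity)]
    exact le_top
  -- An increasing exhaustion of `Ω` by closed, bounded, convex sets. Balls of radius `1 / (m + 1)`
  -- around points of `K m` stay in `Ω`, so the thickening by half that radius does too.
  let K : ℕ → Set (E n) := fun m =>
    {x | ‖x‖ ≤ m} ∩ {x | ∀ b : E n, ‖b‖ < 1 / ((m : ℝ) + 1) → x + b ∈ Ω}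
  have hpos : ∀ m : ℕ, (0 : ℝ) < 1 / ((m : ℝ) + 1) := fun m => by positivity
  have hKΩ : ∀ m, K m ⊆ Ω := fun m x hx => by simpa using hx.2 0 (by simpa using hpos m)
  have hKmono : Monotone K := by
    intro m m' hm x hx
    have hmm : (m : ℝ) ≤ m' := by exact_mod_cast hm
    refine ⟨hx.1.trans hmm, fun b hb => hx.2 b (hb.trans_le ?_)⟩
    gcongr
  have hKclosed : ∀ m, IsClosed (K m) := by
    intro m
    refine (isClosed_le continuous_norm continuous_const).inter ?_
    rw [← isOpen_compl_iff, Metric.isOpen_iff]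
    intro x hx
    simp only [mem_compl_iff, mem_ofPred_eq, not_forall] at hx
    obtain ⟨b, hb, hbΩ⟩ := hx
    refine ⟨1 / ((m : ℝ) + 1) - ‖b‖, sub_pos.2 hb, fun y hy => ?_⟩
    simp only [mem_compl_iff, mem_ofPred_eq, not_forall]
    refine ⟨x + b - y, ?_, by simpa using hbΩ⟩
    rw [mem_ball_iff_norm, norm_sub_rev] at hy
    calc ‖x + b - y‖ = ‖b + (x - y)‖ := by congr 1; abel
      _ ≤ ‖b‖ + ‖x - y‖ := norm_add_le _ _
      _ < _ := by linarith
  have hKconvex : ∀ m, Convex ℝ (K m) := by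
    intro m
    refine Convex.inter ?_ ?_
    · have : {x : E n | ‖x‖ ≤ m} = Metric.closedBall 0 m := by ext; simp
      rw [this]; exact convex_closedBall _ _
    · intro x hx y hy a b ha hb hab v hv
      have := hV.1 (hx v hv) (hy v hv) ha hb hab
      have e : a • x + b • y + v = a • (x + v) + b • (y + v) := by
        rw [smul_add, smul_add, add_add_add_comm, ← add_smul, hab, one_smul]
      rw [mem_ofPred_eq] at *
      rw [e]; exact this
  have hKb : ∀ m, Bornology.IsBounded (K m) := fun m =>
    (Metric.isBounded_closedBall (x := (0 : E n)) (r := m)).subset fun x hx => by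
      simpa using hx.1
  have hKunion : ⋃ m, K m = Ω := by
    refine subset_antisymm (iUnion_subset hKΩ) fun x hx => ?_
    obtain ⟨ε, hε, hball⟩ := Metric.isOpen_iff.1 hΩ x hx
    obtain ⟨m₁, hm₁⟩ := exists_nat_ge ‖x‖
    obtain ⟨m₂, hm₂⟩ := exists_nat_one_div_lt hε
    refine mem_iUnion.2 ⟨max m₁ m₂, ?_, fun b hb => hball ?_⟩
    · exact hm₁.trans (by exact_mod_cast le_max_left _ _)
    · rw [mem_ball_iff_norm, add_sub_cancel_left]
      refine hb.trans (lt_of_le_of_lt ?_ hm₂)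
      gcongr
      exact le_max_right _ _
  have hbound : ∀ m, ∫⁻ x in K m, ∫⁻ y in K m, ‖f x - f y‖ₑ ^ 2 ∂μ ∂μ
      ≤ ENNReal.ofReal (4 / α) * (μ univ * ∫⁻ x, ‖fderiv ℝ f x‖ₑ ^ 2 ∂μ) := by
    intro m
    rw [← gibbsMeasure_eq_restrict (hKclosed m).measurableSet hΩ.measurableSet (hKΩ m)]
    refine lintegral_lintegral_sq_sub_le_of_cthickening_subset (r := 1 / ((m : ℝ) + 1) / 2) hα hV hΩ
      (hKclosed m).measurableSet (hKconvex m) (hKb m) (half_pos (hpos m)) ?_ hf hfd hi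
    refine (Metric.cthickening_subset_thickening' (hpos m) (half_lt_self (hpos m)) _).trans ?_
    intro y hy
    obtain ⟨x, hx, hxy⟩ := Metric.mem_thickening_iff.1 hy
    have := hx.2 (y - x) (by rwa [← dist_eq_norm])
    simpa using this
  have hres : μ.restrict Ω = μ := by
    rw [hμ, ← gibbsMeasure_eq_restrict hΩ.measurableSet hΩ.measurableSet subset_rfl]
  -- Monotone convergence is used in each variable separately, which calls for independent indices.
  have hprod : ∀ (m m' : ℕ), ∫⁻ x in K m, ∫⁻ y in K m', ‖f x - f y‖ₑ ^ 2 ∂μ ∂μ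
      ≤ ENNReal.ofReal (4 / α) * (μ univ * ∫⁻ x, ‖fderiv ℝ f x‖ₑ ^ 2 ∂μ) := fun m m' =>
    (lintegral_mono' (Measure.restrict_mono (hKmono (le_max_left m m')) le_rfl) fun x =>
      lintegral_mono' (Measure.restrict_mono (hKmono (le_max_right m m')) le_rfl) le_rfl).trans
      (hbound (max m m'))
  have hsf : SFinite μ := by rw [hμ, gibbsMeasure]; infer_instance
  have hmeas : ∀ s : Set (E n), Measurable fun x => ∫⁻ y in s, ‖f x - f y‖ₑ ^ 2 ∂μ := fun s =>
    Measurable.lintegral_prod_right' (f := fun p : E n × E n => ‖f p.1 - f p.2‖ₑ ^ 2)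
      (by fun_prop)
  generalize ENNReal.ofReal (4 / α) * (μ univ * ∫⁻ x, ‖fderiv ℝ f x‖ₑ ^ 2 ∂μ) = T at hprod ⊢
  rw [← hres, ← hKunion, setLIntegral_iUnion_of_directed _ hKmono.directed_le]
  simp_rw [setLIntegral_iUnion_of_directed _ hKmono.directed_le]
  refine iSup_le fun m => ?_
  rw [lintegral_iSup (fun m' => hmeas _) fun i j hij x =>
    lintegral_mono' (Measure.restrict_mono (hKmono hij) le_rfl) le_rfl]
  refine iSup_le fun m' => ?_
  exact hprod m m'

/-- The Poincaré inequality for a weight comparable to a strongly log-concave one. -/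
theorem lintegral_lintegral_sq_sub_le_of_comparable {n : ℕ} {Ω : Set (E n)} {V w : E n → ℝ}
    {α c C : ℝ} (hα : 0 < α) (hc : 0 < c) (hV : StrongConvexOn Ω α V) (hΩ : IsOpen Ω)
    (hcw : ∀ x ∈ Ω, c * Real.exp (-V x) ≤ w x) (hwC : ∀ x ∈ Ω, w x ≤ C * Real.exp (-V x))
    (hmem : ∀ᵐ x ∂(densityMeasure w), x ∈ Ω)
    {f : E n → ℝ} (hf : Measurable f) (hfd : ∀ x ∈ Ω, DifferentiableAt ℝ f x) :
    ∫⁻ x, ∫⁻ y, ‖f x - f y‖ₑ ^ 2 ∂(densityMeasure w) ∂(densityMeasure w)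
      ≤ ENNReal.ofReal C ^ 2 * ENNReal.ofReal (4 / α) * ENNReal.ofReal c⁻¹ ^ 2 *
        (densityMeasure w univ * ∫⁻ x, ‖fderiv ℝ f x‖ₑ ^ 2 ∂(densityMeasure w)) := by
  set ν := densityMeasure w with hν
  have hνΩ : ν = (volume.restrict Ω).withDensity fun x => ENNReal.ofReal (w x) := by
    rw [← Measure.restrict_eq_self_of_ae_mem hmem, hν, densityMeasure,
      restrict_withDensity hΩ.measurableSet]
  have hg := gibbsMeasure_eq_withDensity_restrict hΩ.measurableSet V
  -- Each side of Poincaré is quadratic in the measure, so this comparison and the reverse one enter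
  -- as `C²` and `c⁻²`.
  have h1 : ν ≤ ENNReal.ofReal C • gibbsMeasure Ω V := by
    rw [hνΩ, hg, ← withDensity_smul' _ _ ofReal_ne_top]
    refine withDensity_mono (ae_restrict_of_forall_mem hΩ.measurableSet fun x hx => ?_)
    rw [Pi.smul_apply, smul_eq_mul, ← ENNReal.ofReal_mul' (Real.exp_pos _).le]
    exact ENNReal.ofReal_le_ofReal (hwC x hx)
  have h2 : gibbsMeasure Ω V ≤ ENNReal.ofReal c⁻¹ • ν := by
    rw [hνΩ, hg, ← withDensity_smul' _ _ ofReal_ne_top]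
    refine withDensity_mono (ae_restrict_of_forall_mem hΩ.measurableSet fun x hx => ?_)
    rw [Pi.smul_apply, smul_eq_mul, ← ENNReal.ofReal_mul (inv_pos.2 hc).le]
    refine ENNReal.ofReal_le_ofReal ?_
    rw [inv_mul_eq_div, le_div_iff₀ hc, mul_comm]
    exact hcw x hx
  calc ∫⁻ x, ∫⁻ y, ‖f x - f y‖ₑ ^ 2 ∂ν ∂ν
      ≤ ∫⁻ x, ∫⁻ y, ‖f x - f y‖ₑ ^ 2 ∂(ENNReal.ofReal C • gibbsMeasure Ω V)
          ∂(ENNReal.ofReal C • gibbsMeasure Ω V) :=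
        lintegral_mono' h1 fun x => lintegral_mono' h1 le_rfl
    _ = ENNReal.ofReal C ^ 2 *
          ∫⁻ x, ∫⁻ y, ‖f x - f y‖ₑ ^ 2 ∂(gibbsMeasure Ω V) ∂(gibbsMeasure Ω V) := by
        simp only [lintegral_smul_measure, smul_eq_mul]
        rw [lintegral_const_mul' _ _ ofReal_ne_top, ← mul_assoc, sq]
    _ ≤ ENNReal.ofReal C ^ 2 * (ENNReal.ofReal (4 / α) * (gibbsMeasure Ω V univ *
          ∫⁻ x, ‖fderiv ℝ f x‖ₑ ^ 2 ∂(gibbsMeasure Ω V))) :=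
        mul_le_mul' le_rfl (lintegral_lintegral_sq_sub_le_of_isOpen hα hV hΩ hf hfd)
    _ ≤ ENNReal.ofReal C ^ 2 * (ENNReal.ofReal (4 / α) * ((ENNReal.ofReal c⁻¹ • ν) univ *
          ∫⁻ x, ‖fderiv ℝ f x‖ₑ ^ 2 ∂(ENNReal.ofReal c⁻¹ • ν))) :=
        mul_le_mul' le_rfl (mul_le_mul' le_rfl (mul_le_mul' (h2 univ) (lintegral_mono' h2 le_rfl)))
    _ = _ := by
        rw [lintegral_smul_measure, Measure.smul_apply, smul_eq_mul, smul_eq_mul]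
        ring

/-! ### Orthogonal coordinates: active and inactive variables. -/

section Splitting

variable {D d : ℕ} (hd : d < D)

/-- The coordinates of `ℝᴰ`, split into the first `d` and the last `D - d`. -/
def splitEquiv : Fin d ⊕ Fin (D - d) ≃ Fin D :=
  finSumFinEquiv.trans (finCongr (by omega))

theorem splitEquiv_inl (i : Fin d) : splitEquiv hd (Sum.inl i) = Fin.castLE hd.le i := by
  ext; simp [splitEquiv]

theorem splitEquiv_inr (j : Fin (D - d)) :
    splitEquiv hd (Sum.inr j) = ⟨d + j.val, by omega⟩ := by
  ext; simp [splitEquiv]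

variable {W : Matrix (Fin D) (Fin D) ℝ}

theorem recombine_ofLp (y : E d) (z : E (D - d)) :
    (recombine hd W y z).ofLp
      = W.mulVec (fun k => Sum.elim y.ofLp z.ofLp ((splitEquiv hd).symm k)) := by
  ext a
  simp only [recombine, Matrix.mulVec, dotProduct, Pi.add_apply]
  rw [← (splitEquiv hd).sum_comp, Fintype.sum_sum_type]
  simp only [Equiv.symm_apply_apply, Sum.elim_inl, Sum.elim_inr]
  simp [splitEquiv_inl, splitEquiv_inr, activeBlock, inactiveBlock]

theorem transpose_mul_apply_of_orthogonal (hW : W ∈ Matrix.orthogonalGroup (Fin D) ℝ)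
    (i j : Fin D) : ∑ a, W a i * W a j = if i = j then 1 else 0 := by
  have h := congrFun (congrFun ((Matrix.mem_orthogonalGroup_iff' _ _).1 hW) i) j
  simpa [Matrix.mul_apply, Matrix.one_apply] using h

theorem mul_transpose_apply_of_orthogonal (hW : W ∈ Matrix.orthogonalGroup (Fin D) ℝ)
    (i j : Fin D) : ∑ a, W i a * W j a = if i = j then 1 else 0 := by
  have h := congrFun (congrFun ((Matrix.mem_orthogonalGroup_iff _ _).1 hW) i) j
  simpa [Matrix.mul_apply, Matrix.one_apply] using h

theorem activeVar_recombine (hW : W ∈ Matrix.orthogonalGroup (Fin D) ℝ) (y : E d)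
    (z : E (D - d)) : activeVar hd W (recombine hd W y z) = y := by
  ext i
  have e : (activeVar hd W (recombine hd W y z)).ofLp i
      = (W.transpose.mulVec (recombine hd W y z).ofLp) (splitEquiv hd (Sum.inl i)) := by
    rw [splitEquiv_inl]; rfl
  have h1 : W.transpose * W = 1 := (Matrix.mem_orthogonalGroup_iff' _ _).1 hW
  rw [e, recombine_ofLp, Matrix.mulVec_mulVec, h1, Matrix.one_mulVec]
  simp

/-- The map is a regrouping of coordinates followed by `W`, and `|det W| = 1`. -/
theorem measurePreserving_recombine (hW : W ∈ Matrix.orthogonalGroup (Fin D) ℝ) :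
    MeasurePreserving (fun p : E d × E (D - d) => recombine hd W p.1 p.2)
      (volume.prod volume) volume := by
  have hdet : |W.det| = 1 := by
    have h1 : W.transpose * W = 1 := (Matrix.mem_orthogonalGroup_iff' _ _).1 hW
    have h2 := congrArg Matrix.det h1
    rw [Matrix.det_mul, Matrix.det_transpose, Matrix.det_one, ← sq] at h2
    have h3 : |W.det| ^ 2 = 1 := by rw [sq_abs, h2]
    exact (pow_eq_one_iff_of_nonneg (abs_nonneg _) two_ne_zero).1 h3
  have hdet0 : W.det ≠ 0 := by intro h; simp [h] at hdet
  have m1 : MeasurePreserving (fun p : E d × E (D - d) => (p.1.ofLp, p.2.ofLp))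
      (volume.prod volume) (volume.prod volume) :=
    (PiLp.volume_preserving_ofLp (Fin d)).prod (PiLp.volume_preserving_ofLp (Fin (D - d)))
  have m2 := (volume_measurePreserving_sumPiEquivProdPi
    (fun _ : Fin d ⊕ Fin (D - d) => ℝ)).symm
  have m3 := volume_measurePreserving_piCongrLeft (fun _ : Fin D => ℝ) (splitEquiv hd)
  have m4 : MeasurePreserving (Matrix.toLin' W) (volume : Measure (Fin D → ℝ)) volume :=
    ⟨(LinearMap.continuous_of_finiteDimensional _).measurable, by
      rw [Real.map_matrix_volume_pi_eq_smul_volume_pi hdet0, abs_inv, hdet]; simp⟩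
  have m5 := PiLp.volume_preserving_toLp (Fin D)
  have := m5.comp (m4.comp (m3.comp (m2.comp m1)))
  have e : (fun p : E d × E (D - d) => recombine hd W p.1 p.2)
      = WithLp.toLp 2 ∘ Matrix.toLin' W ∘
        MeasurableEquiv.piCongrLeft (fun _ : Fin D => ℝ) (splitEquiv hd) ∘
        (MeasurableEquiv.sumPiEquivProdPi (fun _ : Fin d ⊕ Fin (D - d) => ℝ)).symm ∘
        fun p : E d × E (D - d) => (p.1.ofLp, p.2.ofLp) := by
    funext p
    refine (WithLp.ofLp_injective 2) ?_
    rw [recombine_ofLp]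
    simp only [Function.comp_apply, Matrix.toLin'_apply]
    congr 1
    ext k
    obtain ⟨k, rfl⟩ := (splitEquiv hd).surjective k
    rw [MeasurableEquiv.coe_piCongrLeft, Equiv.piCongrLeft_apply_apply]
    rcases k with k | k <;> simp [MeasurableEquiv.sumPiEquivProdPi, Equiv.sumPiEquivProdPi]
  rw [e]
  exact this

/-- The linear map `z ↦ W₂ z`. -/
def inactiveMap (W : Matrix (Fin D) (Fin D) ℝ) : E (D - d) →L[ℝ] E D :=
  LinearMap.toContinuousLinearMap
    ((WithLp.linearEquiv 2 ℝ (Fin D → ℝ)).symm.toLinearMap ∘ₗ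
      Matrix.toLin' (inactiveBlock hd W) ∘ₗ (WithLp.linearEquiv 2 ℝ (Fin (D - d) → ℝ)).toLinearMap)

theorem inactiveMap_ofLp (z : E (D - d)) :
    (inactiveMap hd W z).ofLp = (inactiveBlock hd W).mulVec z.ofLp := rfl

theorem recombine_eq_add (y : E d) (z : E (D - d)) :
    recombine hd W y z = recombine hd W y 0 + inactiveMap hd W z := by
  ext a
  simp [recombine, inactiveMap_ofLp]

/-- The vector `W₂ᵀ x`. -/
def inactiveVar (W : Matrix (Fin D) (Fin D) ℝ) (x : E D) : E (D - d) :=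
  WithLp.toLp 2 ((inactiveBlock hd W).transpose.mulVec x.ofLp)

theorem inner_inactiveMap (x : E D) (z : E (D - d)) :
    inner ℝ x (inactiveMap hd W z) = inner ℝ (inactiveVar hd W x) z := by
  simp only [EuclideanSpace.inner_eq_star_dotProduct, inactiveMap_ofLp, inactiveVar, star_trivial]
  rw [Matrix.mulVec_transpose, dotProduct_comm, Matrix.dotProduct_mulVec, dotProduct_comm]

theorem inactiveVar_inactiveMap (hW : W ∈ Matrix.orthogonalGroup (Fin D) ℝ) (z : E (D - d)) :
    inactiveVar hd W (inactiveMap hd W z) = z := by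
  have h : (inactiveBlock hd W).transpose * inactiveBlock hd W = 1 := by
    ext i j
    simp only [Matrix.mul_apply, Matrix.transpose_apply, inactiveBlock, Matrix.submatrix_apply,
      id, transpose_mul_apply_of_orthogonal hW, Matrix.one_apply]
    congr 1
    simp [Fin.ext_iff]
  ext i
  simp [inactiveVar, inactiveMap_ofLp, Matrix.mulVec_mulVec, h]

theorem norm_inactiveMap (hW : W ∈ Matrix.orthogonalGroup (Fin D) ℝ) (z : E (D - d)) :
    ‖inactiveMap hd W z‖ = ‖z‖ := by
  have h := inner_inactiveMap hd (W := W) (inactiveMap hd W z) z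
  rw [inactiveVar_inactiveMap hd hW, real_inner_self_eq_norm_sq, real_inner_self_eq_norm_sq] at h
  exact (pow_left_inj₀ (norm_nonneg _) (norm_nonneg _) two_ne_zero).1 h

/-- Fibers are embedded isometrically; together with `recombine_affine` this keeps the strong
convexity modulus `α` on every fiber. -/
theorem norm_sub_recombine (hW : W ∈ Matrix.orthogonalGroup (Fin D) ℝ) (y : E d)
    (z z' : E (D - d)) : ‖recombine hd W y z - recombine hd W y z'‖ = ‖z - z'‖ := by
  rw [recombine_eq_add, recombine_eq_add hd y z', add_sub_add_left_eq_sub, ← map_sub,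
    norm_inactiveMap hd hW]

theorem recombine_affine (y : E d) (z z' : E (D - d)) {a b : ℝ} (hab : a + b = 1) :
    recombine hd W y (a • z + b • z') = a • recombine hd W y z + b • recombine hd W y z' := by
  rw [recombine_eq_add, recombine_eq_add hd y z, recombine_eq_add hd y z', map_add, map_smul,
    map_smul, smul_add, smul_add, add_add_add_comm, ← add_smul, hab, one_smul]

theorem hasFDerivAt_recombine (y : E d) (z : E (D - d)) :
    HasFDerivAt (recombine hd W y) (inactiveMap hd W) z := by
  have : recombine hd W y = fun z => recombine hd W y 0 + inactiveMap hd W z :=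
    funext fun z => recombine_eq_add hd y z
  rw [this]
  exact (inactiveMap hd W).hasFDerivAt.const_add _

/-- By the chain rule, the gradient along the fiber is `W₂ᵀ ∇f`. -/
theorem enorm_fderiv_comp_recombine_le {f : E D → ℝ} {y : E d} {z : E (D - d)}
    (hf : DifferentiableAt ℝ f (recombine hd W y z)) :
    ‖fderiv ℝ (fun z => f (recombine hd W y z)) z‖ₑ
      ≤ ‖inactiveVar hd W (gradient f (recombine hd W y z))‖ₑ := by
  have hcomp : fderiv ℝ (fun z => f (recombine hd W y z)) z
      = (fderiv ℝ f (recombine hd W y z)).comp (inactiveMap hd W) :=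
    (hf.hasFDerivAt.comp z (hasFDerivAt_recombine hd y z)).fderiv
  rw [hcomp, enorm_le_iff_norm_le]
  refine ContinuousLinearMap.opNorm_le_bound _ (norm_nonneg _) fun v => ?_
  have h : fderiv ℝ f (recombine hd W y z) (inactiveMap hd W v)
      = inner ℝ (gradient f (recombine hd W y z)) (inactiveMap hd W v) := by
    rw [gradient, InnerProductSpace.toDual_symm_apply]
  rw [ContinuousLinearMap.comp_apply, h, inner_inactiveMap]
  exact norm_inner_le_norm _ _

end Splitting

/-! ### The gradient covariance and its eigenvalues. -/

theorem integrable_gradient_mul {D : ℕ} {ρ f : E D → ℝ}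
    (hg : MemLp (gradient f) 2 (densityMeasure ρ)) (a b : Fin D) :
    Integrable (fun x => gradient f x a * gradient f x b) (densityMeasure ρ) := by
  have h : ∀ a : Fin D, MemLp (fun x => gradient f x a) 2 (densityMeasure ρ) := fun a =>
    (EuclideanSpace.proj (𝕜 := ℝ) a).comp_memLp' hg
  exact (h a).integrable_mul (h b)

/-- Both sides are the quadratic form `uᵀ Σ_f u`, the right one written in the eigenbasis. -/
theorem integral_sq_sum_gradient {D : ℕ} {ρ f : E D → ℝ}
    (hg : MemLp (gradient f) 2 (densityMeasure ρ)) {W : Matrix (Fin D) (Fin D) ℝ}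
    {lam : Fin D → ℝ} (hW : IsEigendecomposition (gradientCovariance ρ f) W lam)
    (u : Fin D → ℝ) :
    ∫ x, (∑ a, u a * gradient f x a) ^ 2 ∂(densityMeasure ρ)
      = ∑ i, lam i * (∑ a, W a i * u a) ^ 2 := by
  have hi := integrable_gradient_mul hg
  have hS : ∀ a b, ∫ x, gradient f x a * gradient f x b ∂(densityMeasure ρ)
      = ∑ i, W a i * lam i * W b i := by
    intro a b
    have h := congrFun (congrFun hW.eq_mul a) b
    rw [Matrix.mul_apply] at h
    simpa [gradientCovariance, Matrix.mul_diagonal] using h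
  have e1 : ∀ x, (∑ a, u a * gradient f x a) ^ 2
      = ∑ a, ∑ b, u a * u b * (gradient f x a * gradient f x b) := by
    intro x
    rw [sq, Finset.sum_mul_sum]
    exact Finset.sum_congr rfl fun a _ => Finset.sum_congr rfl fun b _ => by ring
  simp_rw [e1]
  rw [integral_finsetSum _ fun a _ => integrable_finsetSum _ fun b _ => (hi a b).const_mul _]
  simp_rw [integral_finsetSum _ fun b _ => (hi _ b).const_mul _, integral_const_mul, hS]
  have e2 : ∀ i, lam i * (∑ a, W a i * u a) ^ 2
      = ∑ a, ∑ b, u a * u b * (W a i * lam i * W b i) := by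
    intro i
    rw [sq, Finset.sum_mul_sum, Finset.mul_sum]
    refine Finset.sum_congr rfl fun a _ => ?_
    rw [Finset.mul_sum]
    exact Finset.sum_congr rfl fun b _ => by ring
  simp_rw [e2, Finset.mul_sum]
  symm
  rw [Finset.sum_comm]
  exact Finset.sum_congr rfl fun a _ => Finset.sum_comm

theorem eigenvalue_nonneg {D : ℕ} {ρ f : E D → ℝ}
    (hg : MemLp (gradient f) 2 (densityMeasure ρ)) {W : Matrix (Fin D) (Fin D) ℝ}
    {lam : Fin D → ℝ} (hW : IsEigendecomposition (gradientCovariance ρ f) W lam) (i : Fin D) :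
    0 ≤ lam i := by
  have h := integral_sq_sum_gradient hg hW (fun a => W a i)
  simp only [transpose_mul_apply_of_orthogonal hW.orthogonal] at h
  simp only [ite_pow, one_pow, ne_eq, two_ne_zero, not_false_eq_true, zero_pow, mul_ite, mul_one,
    mul_zero, Finset.sum_ite_eq', Finset.mem_univ, if_true] at h
  rw [← h]
  exact integral_nonneg fun x => sq_nonneg _

theorem sum_comp_inactive_le {D d : ℕ} (hd : d < D) {u : Fin D → ℝ} (hu : ∀ k, 0 ≤ u k) :
    ∑ j : Fin (D - d), u ⟨d + j.val, by omega⟩ ≤ ∑ k, u k := by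
  rw [← (splitEquiv hd).sum_comp, Fintype.sum_sum_type]
  simp only [splitEquiv_inr]
  exact le_add_of_nonneg_left (Finset.sum_nonneg fun _ _ => hu _)

/-- For the unit column `v` of `W` and `w = Aᵀ v`, one has `‖w‖² = ⟨A w, v⟩ ≤ δ ‖w‖`. -/
theorem sum_sq_transpose_mul_le {D : ℕ} {W A : Matrix (Fin D) (Fin D) ℝ} {δ : ℝ}
    (hW : W ∈ Matrix.orthogonalGroup (Fin D) ℝ)
    (hA : ‖Matrix.toEuclideanCLM (n := Fin D) (𝕜 := ℝ) A‖ ≤ δ) (i : Fin D) :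
    ∑ k, (∑ a, W a i * A a k) ^ 2 ≤ δ ^ 2 := by
  set v : E D := WithLp.toLp 2 fun a => W a i with hv
  have hv1 : ‖v‖ = 1 := by
    have : ‖v‖ ^ 2 = 1 := by
      rw [EuclideanSpace.real_norm_sq_eq]
      have := transpose_mul_apply_of_orthogonal hW i i
      simpa [hv, sq] using this
    exact (pow_eq_one_iff_of_nonneg (norm_nonneg _) two_ne_zero).1 this
  set w : E D := WithLp.toLp 2 (A.transpose.mulVec v.ofLp) with hw
  have hinner : inner ℝ (Matrix.toEuclideanCLM (n := Fin D) (𝕜 := ℝ) A w) v = ‖w‖ ^ 2 := by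
    rw [← real_inner_self_eq_norm_sq]
    simp only [EuclideanSpace.inner_eq_star_dotProduct, star_trivial, Matrix.ofLp_toEuclideanCLM]
    rw [Matrix.dotProduct_mulVec, ← Matrix.mulVec_transpose]
  have h1 : ‖w‖ ^ 2 ≤ δ * ‖w‖ := by
    rw [← hinner]
    refine (real_inner_le_norm _ _).trans ?_
    rw [hv1, mul_one]
    exact (Matrix.toEuclideanCLM (n := Fin D) (𝕜 := ℝ) A).le_of_opNorm_le hA w
  have h2 : ‖w‖ ≤ δ := by
    rcases (norm_nonneg w).eq_or_lt with h0 | h0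
    · rw [← h0]; exact (norm_nonneg _).trans hA
    · rw [sq] at h1; exact le_of_mul_le_mul_right h1 h0
  refine le_trans (le_of_eq ?_) (pow_le_pow_left₀ (norm_nonneg _) h2 2)
  rw [EuclideanSpace.real_norm_sq_eq]
  refine Finset.sum_congr rfl fun k _ => ?_
  simp [hw, hv, Matrix.mulVec, dotProduct, mul_comm]

/-- The mean squared inactive part of the gradient, bounded in terms of the eigenvalues. -/
theorem lintegral_inactiveVar_gradient_le {D d : ℕ} (hd : d < D) {ρ f : E D → ℝ}
    (hg : MemLp (gradient f) 2 (densityMeasure ρ)) {W Wc : Matrix (Fin D) (Fin D) ℝ}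
    {lam : Fin D → ℝ} {δ : ℝ} (hW : IsEigendecomposition (gradientCovariance ρ f) W lam)
    (hWc : Wc ∈ Matrix.orthogonalGroup (Fin D) ℝ)
    (hδ : ‖Matrix.toEuclideanCLM (n := Fin D) (𝕜 := ℝ) (W - Wc)‖ ≤ δ) :
    ∫⁻ x, ‖inactiveVar hd Wc (gradient f x)‖ₑ ^ 2 ∂(densityMeasure ρ)
      ≤ ENNReal.ofReal ((δ * Real.sqrt (∑ i : Fin D with i.val < d, lam i)
          + Real.sqrt (∑ i : Fin D with d ≤ i.val, lam i)) ^ 2) := by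
  have hδ0 : 0 ≤ δ := (norm_nonneg _).trans hδ
  have hlam := eigenvalue_nonneg hg hW
  let col : Fin (D - d) → Fin D := fun j => ⟨d + j.val, by omega⟩
  have hnorm : ∀ x, ‖inactiveVar hd Wc (gradient f x)‖ ^ 2
      = ∑ j, (∑ a, Wc a (col j) * gradient f x a) ^ 2 := by
    intro x
    rw [EuclideanSpace.real_norm_sq_eq]
    rfl
  have hint : ∀ u : Fin D → ℝ,
      Integrable (fun x => (∑ a, u a * gradient f x a) ^ 2) (densityMeasure ρ) := by
    intro u
    have h : ∀ a : Fin D, MemLp (fun x => gradient f x a) 2 (densityMeasure ρ) := fun a =>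
      (EuclideanSpace.proj (𝕜 := ℝ) a).comp_memLp' hg
    exact (memLp_finsetSum _ fun a _ => (h a).const_mul (u a)).integrable_sq
  have hreal : ∫ x, ‖inactiveVar hd Wc (gradient f x)‖ ^ 2 ∂(densityMeasure ρ)
      = ∑ i, lam i * ∑ j, (∑ a, W a i * Wc a (col j)) ^ 2 := by
    simp_rw [hnorm]
    rw [integral_finsetSum _ fun j _ => hint _]
    simp_rw [integral_sq_sum_gradient hg hW, Finset.mul_sum]
    rw [Finset.sum_comm]
  -- The full sum over `k` is the squared norm of a row of the orthogonal matrix `Wᵀ Wc`.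
  have hall : ∀ i, ∑ j, (∑ a, W a i * Wc a (col j)) ^ 2 ≤ 1 := by
    intro i
    refine (sum_comp_inactive_le hd (u := fun k => (∑ a, W a i * Wc a k) ^ 2)
      fun k => sq_nonneg _).trans (le_of_eq ?_)
    have hM : (W.transpose * Wc) ∈ Matrix.orthogonalGroup (Fin D) ℝ :=
      mul_mem (Unitary.star_mem hW.orthogonal) hWc
    have := mul_transpose_apply_of_orthogonal hM i i
    simpa [Matrix.mul_apply, sq] using this
  -- For active `i` the column `wᵢ` is orthogonal to the exact inactive columns, so replacing `Wc`
  -- by `W - Wc` changes only the sign of the inner product.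
  have hact : ∀ i : Fin D, i.val < d → ∑ j, (∑ a, W a i * Wc a (col j)) ^ 2 ≤ δ ^ 2 := by
    intro i hi
    have h := sum_sq_transpose_mul_le hW.orthogonal hδ i
    refine le_trans (le_of_eq ?_) ((sum_comp_inactive_le hd
      (u := fun k => (∑ a, W a i * (W - Wc) a k) ^ 2) fun k => sq_nonneg _).trans h)
    refine Finset.sum_congr rfl fun j _ => ?_
    have h0 := transpose_mul_apply_of_orthogonal hW.orthogonal i (col j)
    rw [if_neg (by intro h; have := congrArg Fin.val h; simp only [col] at this; omega)] at h0
    simp only [Matrix.sub_apply, mul_sub, Finset.sum_sub_distrib]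
    rw [h0, zero_sub, neg_sq]
  have hsum : ∑ i, lam i * ∑ j, (∑ a, W a i * Wc a (col j)) ^ 2
      ≤ δ ^ 2 * (∑ i : Fin D with i.val < d, lam i) + ∑ i : Fin D with d ≤ i.val, lam i := by
    rw [← Finset.sum_filter_add_sum_filter_not Finset.univ (fun i : Fin D => i.val < d)]
    simp only [not_lt]
    rw [Finset.mul_sum]
    refine add_le_add (Finset.sum_le_sum fun i hi => ?_) (Finset.sum_le_sum fun i hi => ?_)
    · rw [mul_comm]
      exact mul_le_mul_of_nonneg_right (hact i (Finset.mem_filter.1 hi).2) (hlam i)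
    · exact mul_le_of_le_one_right (hlam i) (hall i)
  have hA : 0 ≤ ∑ i : Fin D with i.val < d, lam i := Finset.sum_nonneg fun i _ => hlam i
  have hB : 0 ≤ ∑ i : Fin D with d ≤ i.val, lam i := Finset.sum_nonneg fun i _ => hlam i
  have e : ∫⁻ x, ‖inactiveVar hd Wc (gradient f x)‖ₑ ^ 2 ∂(densityMeasure ρ)
      = ENNReal.ofReal (∫ x, ‖inactiveVar hd Wc (gradient f x)‖ ^ 2 ∂(densityMeasure ρ)) := by
    rw [ofReal_integral_eq_lintegral_ofReal]
    · refine lintegral_congr fun x => ?_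
      rw [ENNReal.ofReal_pow (norm_nonneg _), ofReal_norm]
    · simp_rw [hnorm]
      exact integrable_finsetSum _ fun j _ => hint _
    · exact ae_of_all _ fun x => sq_nonneg _
  rw [e, hreal]
  refine ENNReal.ofReal_le_ofReal (hsum.trans ?_)
  have h1 := Real.sq_sqrt hA
  have h2 := Real.sq_sqrt hB
  have h3 : 0 ≤ δ * Real.sqrt (∑ i : Fin D with i.val < d, lam i)
      * Real.sqrt (∑ i : Fin D with d ≤ i.val, lam i) := by positivity
  nlinarith

/-! ### Poincaré on the fibers and the error of a single sample. -/

section Fibers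

variable {D d : ℕ} (hd : d < D) {W : Matrix (Fin D) (Fin D) ℝ}

theorem measurable_recombine (W : Matrix (Fin D) (Fin D) ℝ) :
    Measurable fun p : E d × E (D - d) => recombine hd W p.1 p.2 := by
  refine (WithLp.measurable_toLp 2 _).comp (measurable_pi_lambda _ fun a => ?_)
  simp only [Pi.add_apply, Matrix.mulVec, dotProduct]
  fun_prop

theorem measurable_activeVar (W : Matrix (Fin D) (Fin D) ℝ) :
    Measurable (activeVar hd W) := by
  refine (WithLp.measurable_toLp 2 _).comp (measurable_pi_lambda _ fun a => ?_)
  simp only [Matrix.mulVec, dotProduct]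
  fun_prop

theorem IsAdmissibleDensity.nonneg {X : Set (E D)} {ρ : E D → ℝ} (hρ : IsAdmissibleDensity X ρ)
    (x : E D) : 0 ≤ ρ x := by
  obtain ⟨V, α, c, C, -, hc, -, h⟩ := hρ.comparable
  by_cases hx : x ∈ X
  · exact le_trans (by positivity) (h x hx).1
  · rw [hρ.eq_zero_of_notMem x hx]

theorem IsAdmissibleDensity.lintegral_eq_one {X : Set (E D)} {ρ : E D → ℝ}
    (hρ : IsAdmissibleDensity X ρ) : ∫⁻ x, ENNReal.ofReal (ρ x) = 1 := by
  have hi : Integrable ρ := by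
    by_contra h
    have := hρ.integral_eq_one
    rw [integral_undef h] at this
    exact zero_ne_one this
  rw [← ofReal_integral_eq_lintegral_ofReal hi (ae_of_all _ hρ.nonneg), hρ.integral_eq_one,
    ofReal_one]

theorem IsAdmissibleDensity.isProbabilityMeasure {X : Set (E D)} {ρ : E D → ℝ}
    (hρ : IsAdmissibleDensity X ρ) : IsProbabilityMeasure (densityMeasure ρ) :=
  ⟨by rw [densityMeasure, withDensity_apply _ MeasurableSet.univ, setLIntegral_univ,
    hρ.lintegral_eq_one]⟩

/-- Integration against `ρ`, in the coordinates `(y, z)`. -/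
theorem lintegral_densityMeasure_eq {ρ : E D → ℝ} (hρ : Measurable ρ)
    (hW : W ∈ Matrix.orthogonalGroup (Fin D) ℝ) {h : E D → ℝ≥0∞} (hh : Measurable h) :
    ∫⁻ x, h x ∂(densityMeasure ρ)
      = ∫⁻ y, ∫⁻ z, h (recombine hd W y z) ∂(densityMeasure fun z => ρ (recombine hd W y z)) := by
  have hm := measurable_recombine hd W
  have hsec : ∀ y : E d, Measurable fun z => recombine hd W y z := fun y =>
    hm.comp measurable_prodMk_left
  have hz : ∀ y, ∫⁻ z, h (recombine hd W y z) ∂(densityMeasure fun z => ρ (recombine hd W y z))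
      = ∫⁻ z, ENNReal.ofReal (ρ (recombine hd W y z)) * h (recombine hd W y z) := fun y =>
    lintegral_withDensity_eq_lintegral_mul _ ((hρ.comp (hsec y)).ennreal_ofReal)
      (hh.comp (hsec y))
  simp_rw [hz]
  rw [densityMeasure, lintegral_withDensity_eq_lintegral_mul _ hρ.ennreal_ofReal hh,
    ← (measurePreserving_recombine hd hW).lintegral_comp (hρ.ennreal_ofReal.mul hh)]
  exact lintegral_prod _ ((hρ.ennreal_ofReal.mul hh).comp hm).aemeasurable

/-- The frontier of a convex set is null, so by Fubini almost every fiber meets `X` almost only in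
the interior, where `f` is differentiable. -/
theorem ae_recombine_mem_interior {X : Set (E D)} (hX : Convex ℝ X)
    (hW : W ∈ Matrix.orthogonalGroup (Fin D) ℝ) :
    ∀ᵐ y : E d, ∀ᵐ z : E (D - d), recombine hd W y z ∈ X → recombine hd W y z ∈ interior X := by
  have h : ∀ᵐ x : E D, x ∈ X → x ∈ interior X := by
    have h0 : ∀ᵐ x : E D, x ∉ frontier X := measure_eq_zero_iff_ae_notMem.1
      (hX.addHaar_frontier volume)
    filter_upwards [h0] with x hx hxX
    by_contra hxi
    exact hx ⟨subset_closure hxX, hxi⟩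
  exact Measure.ae_ae_of_ae_prod ((measurePreserving_recombine hd hW).quasiMeasurePreserving.ae h)

/-- The Poincaré inequality on the fiber `{W₁ y + W₂ z}`. -/
theorem fiber_poincare {X : Set (E D)} {ρ V : E D → ℝ} {α c C : ℝ} (hα : 0 < α) (hc : 0 < c)
    (hρm : Measurable ρ) (hρ0 : ∀ x, x ∉ X → ρ x = 0) (hV : StrongConvexOn X α V)
    (hcomp : ∀ x ∈ X, c * Real.exp (-V x) ≤ ρ x ∧ ρ x ≤ C * Real.exp (-V x))
    (hW : W ∈ Matrix.orthogonalGroup (Fin D) ℝ) {f : E D → ℝ} (hf : Measurable f)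
    (hfd : ∀ x ∈ interior X, DifferentiableAt ℝ f x) {y : E d}
    (hy : ∀ᵐ z : E (D - d), recombine hd W y z ∈ X → recombine hd W y z ∈ interior X) :
    ∫⁻ z, ∫⁻ z', ‖f (recombine hd W y z) - f (recombine hd W y z')‖ₑ ^ 2
        ∂(densityMeasure fun z => ρ (recombine hd W y z))
        ∂(densityMeasure fun z => ρ (recombine hd W y z))
      ≤ ENNReal.ofReal C ^ 2 * ENNReal.ofReal (4 / α) * ENNReal.ofReal c⁻¹ ^ 2 *
        (densityMeasure (fun z => ρ (recombine hd W y z)) univ *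
          ∫⁻ z, ‖inactiveVar hd W (gradient f (recombine hd W y z))‖ₑ ^ 2
            ∂(densityMeasure fun z => ρ (recombine hd W y z))) := by
  have hsec : Measurable fun z => recombine hd W y z :=
    (measurable_recombine hd W).comp measurable_prodMk_left
  have hcont : Continuous (recombine hd W y) := by
    rw [continuous_iff_continuousAt]
    exact fun z => (hasFDerivAt_recombine hd y z).continuousAt
  set Ω := recombine hd W y ⁻¹' interior X with hΩ
  have hΩo : IsOpen Ω := isOpen_interior.preimage hcont
  have hXi : ∀ z ∈ Ω, recombine hd W y z ∈ X := fun z hz => interior_subset hz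
  have hVs : StrongConvexOn Ω α fun z => V (recombine hd W y z) := by
    refine ⟨fun z hz z' hz' a b ha hb hab => ?_, fun z hz z' hz' a b ha hb hab => ?_⟩
    · rw [hΩ, mem_preimage, recombine_affine hd y z z' hab]
      exact hV.1.interior hz hz' ha hb hab
    · have h := hV.2 (hXi z hz) (hXi z' hz') ha hb hab
      rw [norm_sub_recombine hd hW] at h
      simp only [recombine_affine hd y z z' hab]
      exact h
  have hmem : ∀ᵐ z ∂(densityMeasure fun z => ρ (recombine hd W y z)), z ∈ Ω := by
    have hρy : Measurable fun z => ρ (recombine hd W y z) := hρm.comp hsec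
    rw [densityMeasure, ae_withDensity_iff hρy.ennreal_ofReal]
    filter_upwards [hy] with z hz hne
    refine hz (by_contra fun hx => hne ?_)
    rw [hρ0 _ hx, ofReal_zero]
  refine (lintegral_lintegral_sq_sub_le_of_comparable hα hc hVs hΩo
    (fun z hz => (hcomp _ (hXi z hz)).1) (fun z hz => (hcomp _ (hXi z hz)).2) hmem
    (hf.comp hsec) fun z hz =>
      (hfd _ hz).comp z (hasFDerivAt_recombine hd y z).differentiableAt).trans ?_
  refine mul_le_mul' le_rfl (mul_le_mul' le_rfl (lintegral_mono_ae ?_))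
  filter_upwards [hmem] with z hz
  exact pow_le_pow_left' (enorm_fderiv_comp_recombine_le hd (hfd _ hz)) 2

/-- The mean square distance of `f` to its value at a point sampled from the fiber. -/
theorem lintegral_sq_sub_sample_le {X : Set (E D)} {ρ V : E D → ℝ} {α c C : ℝ} (hα : 0 < α)
    (hc : 0 < c) (hρ : IsAdmissibleDensity X ρ) (hV : StrongConvexOn X α V)
    (hcomp : ∀ x ∈ X, c * Real.exp (-V x) ≤ ρ x ∧ ρ x ≤ C * Real.exp (-V x))
    (hW : W ∈ Matrix.orthogonalGroup (Fin D) ℝ) {f : E D → ℝ} (hf : Measurable f)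
    (hfd : ∀ x ∈ interior X, DifferentiableAt ℝ f x)
    {Ω : Type*} [MeasurableSpace Ω] (P : Measure Ω) [IsProbabilityMeasure P]
    {Z : Ω → E d → E (D - d)} (hZ : Measurable fun p : Ω × E d => Z p.1 p.2)
    (hlaw : ∀ y, 0 < marginalDensity hd W ρ y → P.map (fun ω => Z ω y) =
      volume.withDensity fun z => ENNReal.ofReal (condDensity hd W ρ y z)) :
    ∫⁻ x, ∫⁻ ω, ‖f x - f (recombine hd W (activeVar hd W x) (Z ω (activeVar hd W x)))‖ₑ ^ 2 ∂P
        ∂(densityMeasure ρ)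
      ≤ ENNReal.ofReal C ^ 2 * ENNReal.ofReal (4 / α) * ENNReal.ofReal c⁻¹ ^ 2 *
        ∫⁻ x, ‖inactiveVar hd W (gradient f x)‖ₑ ^ 2 ∂(densityMeasure ρ) := by
  have hrec := measurable_recombine hd W
  have hact := measurable_activeVar hd W
  have hZx : Measurable fun p : E D × Ω => Z p.2 (activeVar hd W p.1) :=
    hZ.comp (measurable_snd.prodMk (hact.comp measurable_fst))
  have hm : Measurable fun p : E D × Ω => ‖f p.1 -
      f (recombine hd W (activeVar hd W p.1) (Z p.2 (activeVar hd W p.1)))‖ₑ ^ 2 :=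
    (((hf.comp measurable_fst).sub (hf.comp
      (hrec.comp ((hact.comp measurable_fst).prodMk hZx)))).enorm).pow_const 2
  have hgrad : Measurable fun x => ‖inactiveVar hd W (gradient f x)‖ₑ ^ 2 := by
    have h1 : Measurable (gradient f) :=
      (InnerProductSpace.toDual ℝ (E D)).symm.continuous.measurable.comp (measurable_fderiv ℝ f)
    have h2 : Measurable (inactiveVar (d := d) hd W) := by
      refine (WithLp.measurable_toLp 2 _).comp (measurable_pi_lambda _ fun a => ?_)
      simp only [Matrix.mulVec, dotProduct]
      fun_prop
    exact (h2.comp h1).enorm.pow_const 2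
  have hρm := hρ.measurable
  rw [lintegral_densityMeasure_eq hd hρm hW hm.lintegral_prod_right',
    lintegral_densityMeasure_eq hd hρm hW hgrad,
    ← lintegral_const_mul' _ _ (by finiteness)]
  simp only [activeVar_recombine hd hW]
  -- Finiteness matters because `marginalDensity` is a Bochner integral, with value `0` on a
  -- nonintegrable fiber; only here does it equal the mass of the fiber measure.
  have hfin : ∀ᵐ y : E d, ∫⁻ z, ENNReal.ofReal (ρ (recombine hd W y z)) < ∞ := by
    have hmeas := hρm.ennreal_ofReal.comp hrec
    refine ae_lt_top hmeas.lintegral_prod_right' ?_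
    have := hρ.lintegral_eq_one
    rw [← (measurePreserving_recombine hd hW).lintegral_comp hρm.ennreal_ofReal] at this
    exact ne_of_eq_of_ne ((lintegral_prod _ hmeas.aemeasurable).symm.trans this) one_ne_top
  refine lintegral_mono_ae ?_
  filter_upwards [hfin, ae_recombine_mem_interior hd hρ.convex hW] with y hyfin hy
  have hsec : Measurable fun z => recombine hd W y z := hrec.comp measurable_prodMk_left
  have hρy : Measurable fun z => ρ (recombine hd W y z) := hρm.comp hsec
  set ν := densityMeasure fun z => ρ (recombine hd W y z) with hν
  set p := marginalDensity hd W ρ y with hp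
  have hνp : ν univ = ENNReal.ofReal p := by
    have hi : Integrable fun z => ρ (recombine hd W y z) := by
      refine ⟨hρy.aestronglyMeasurable, ?_⟩
      rw [hasFiniteIntegral_iff_ofReal (ae_of_all _ fun z => hρ.nonneg _)]
      exact hyfin
    rw [hν, densityMeasure, withDensity_apply _ MeasurableSet.univ, setLIntegral_univ, hp,
      marginalDensity, ofReal_integral_eq_lintegral_ofReal hi (ae_of_all _ fun z => hρ.nonneg _)]
  rcases le_or_gt p 0 with hp0 | hp0
  · have : ν = 0 := by
      rw [← Measure.measure_univ_eq_zero, hνp, ofReal_of_nonpos hp0]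
    simp [this]
  have hcond : P.map (fun ω => Z ω y) = (ENNReal.ofReal p)⁻¹ • ν := by
    rw [hlaw y hp0, hν, densityMeasure, ← withDensity_smul _ hρy.ennreal_ofReal]
    congr 1
    ext z
    rw [condDensity, ENNReal.ofReal_div_of_pos hp0, div_eq_mul_inv, mul_comm]
    rfl
  -- The sample has law `ν / p`. The resulting factor `1 / p` cancels against the mass `ν univ = p`
  -- in the fiber Poincaré inequality, so the constant does not depend on `y`.
  have hinner : ∀ z, ∫⁻ ω, ‖f (recombine hd W y z) - f (recombine hd W y (Z ω y))‖ₑ ^ 2 ∂P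
      = (ENNReal.ofReal p)⁻¹ *
        ∫⁻ z', ‖f (recombine hd W y z) - f (recombine hd W y z')‖ₑ ^ 2 ∂ν := by
    intro z
    have hZy : Measurable fun ω => Z ω y := hZ.comp measurable_prodMk_right
    rw [← smul_eq_mul, ← lintegral_smul_measure, ← hcond, lintegral_map _ hZy]
    exact (measurable_const.sub (hf.comp hsec)).enorm.pow_const 2
  simp_rw [hinner]
  have hp1 : ENNReal.ofReal p ≠ 0 := by simpa using hp0
  rw [lintegral_const_mul' _ _ (ENNReal.inv_ne_top.2 hp1)]
  refine (mul_le_mul' le_rfl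
    (fiber_poincare hd hα hc hρm hρ.eq_zero_of_notMem hV hcomp hW hf hfd hy)).trans (le_of_eq ?_)
  rw [← hν, hνp, mul_left_comm, ← mul_assoc (ENNReal.ofReal p)⁻¹,
    ENNReal.inv_mul_cancel hp1 ofReal_ne_top, one_mul]

end Fibers

end ActiveSubspace

end

/-! ### The error estimate. -/

open ActiveSubspace in
theorem mainTheorem3 {D : ℕ} (X : Set (E D)) (ρ : E D → ℝ) (hρ : IsAdmissibleDensity X ρ) :
    ∃ C₁ : ℝ, 0 < C₁ ∧
      ∀ (d N s : ℕ) (_ : 0 < d) (hd : d < D) (_ : 0 < N)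
        -- the function to be approximated
        (f : E D → ℝ) (_ : Measurable f) (_ : ∀ x ∈ interior X, DifferentiableAt ℝ f x)
        (_ : MemLp f 2 (densityMeasure ρ)) (_ : MemLp (gradient f) 2 (densityMeasure ρ))
        -- exact eigenvectors and eigenvalues, and the computed orthogonal matrix
        (W Wc : Matrix (Fin D) (Fin D) ℝ) (lam : Fin D → ℝ) (δ₁ : ℝ)
        (_ : IsEigendecomposition (gradientCovariance ρ f) W lam)
        (_ : Wc ∈ Matrix.orthogonalGroup (Fin D) ℝ)
        (_ : ‖Matrix.toEuclideanCLM (n := Fin D) (𝕜 := ℝ) (W - Wc)‖ ≤ δ₁)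
        -- Monte Carlo samples
        (Ω : Type*) [MeasurableSpace Ω] (P : Measure Ω) [IsProbabilityMeasure P]
        (Z : Fin N → Ω → E d → E (D - d)) (_ : IsConditionalSampler hd Wc ρ P Z)
        -- Gaussian process regression on the biased training data
        (k : E d → E d → ℝ) (_ : IsCovarianceKernel k)
        (ytr : Fin s → E d) (_ : ∀ i, ytr i ∈ activeVar hd Wc '' X) (_ : IsUnit (gram k ytr).det)
        (β : ℝ) (_ : 0 ≤ β) (C₂ δ₂ : ℝ) (_ : 0 ≤ C₂) (_ : 0 ≤ δ₂)
        (_ : rmsNorm ρ P (fun ω x => fMCBiased hd Wc f Z β ω (activeVar hd Wc x)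
              - fGPRBiased hd Wc f Z k ytr β ω (activeVar hd Wc x))
            ≤ ENNReal.ofReal (C₂ * δ₂)),
        rmsNorm ρ P (fun ω x => f x - fGPRBiased hd Wc f Z k ytr β ω (activeVar hd Wc x))
          ≤ ENNReal.ofReal
              (C₁ * (1 + 1 / Real.sqrt N)
                * (δ₁ * Real.sqrt (∑ i : Fin D with i.val < d, lam i)
                    + Real.sqrt (∑ i : Fin D with d ≤ i.val, lam i))
                + C₂ * δ₂ + β) := by
  obtain ⟨V, α, c, C, hα, hc, hV, hcomp⟩ := hρ.comparable
  have hprob := hρ.isProbabilityMeasure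
  set C₀ : ENNReal :=
    ENNReal.ofReal C ^ 2 * ENNReal.ofReal (4 / α) * ENNReal.ofReal c⁻¹ ^ 2 with hC₀
  have hC₀t : C₀ ≠ ⊤ := by finiteness
  -- The square root undoes the square in the mean square error; adding `1` ensures positivity.
  refine ⟨Real.sqrt C₀.toReal + 1, by positivity, ?_⟩
  intro d N s _ hd hN f hf hfd _ hg W Wc lam δ₁ hW hWc hδ Ω _ P _ Z hZ k hk ytr _ _ β hβ C₂ δ₂
    hC₂ hδ₂ hgpr
  set S := δ₁ * Real.sqrt (∑ i : Fin D with i.val < d, lam i)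
    + Real.sqrt (∑ i : Fin D with d ≤ i.val, lam i) with hS
  set C₁ := Real.sqrt C₀.toReal + 1 with hC₁
  have hδ0 : 0 ≤ δ₁ := (norm_nonneg _).trans hδ
  have hS0 : 0 ≤ S := by positivity
  have hC₁0 : 0 ≤ C₁ := by positivity
  have hC₀C₁ : C₀ ≤ ENNReal.ofReal (C₁ ^ 2) := by
    rw [← ENNReal.ofReal_toReal hC₀t]
    refine ENNReal.ofReal_le_ofReal ?_
    have h1 := Real.sq_sqrt (ENNReal.toReal_nonneg (a := C₀))
    have h2 := Real.sqrt_nonneg C₀.toReal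
    rw [hC₁]; nlinarith
  have hrec := measurable_recombine hd Wc
  have hact := measurable_activeVar hd Wc
  have hact' : Measurable fun p : E D × Ω => activeVar hd Wc p.1 := hact.comp measurable_fst
  have hZx : ∀ i, Measurable fun p : E D × Ω => Z i p.2 (activeVar hd Wc p.1) := fun i =>
    (hZ.measurable i).comp (measurable_snd.prodMk hact')
  have hfz : ∀ i, Measurable fun p : E D × Ω =>
      f (recombine hd Wc (activeVar hd Wc p.1) (Z i p.2 (activeVar hd Wc p.1))) := fun i =>
    hf.comp (hrec.comp (hact'.prodMk (hZx i)))
  have hfx : Measurable fun p : E D × Ω => f p.1 := hf.comp measurable_fst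
  have hMCm : Measurable fun p : E D × Ω => fMCBiased hd Wc f Z β p.2 (activeVar hd Wc p.1) :=
    ((Finset.measurable_fun_sum _ fun i _ => hfz i).const_mul _).add_const β
  have hGPRm : Measurable fun p : E D × Ω =>
      fGPRBiased hd Wc f Z k ytr β p.2 (activeVar hd Wc p.1) := by
    have hMCt : ∀ y, Measurable fun ω => fMCBiased hd Wc f Z β ω y := fun y =>
      ((Finset.measurable_fun_sum _ fun i _ => hf.comp (hrec.comp (measurable_const.prodMk
        ((hZ.measurable i).comp (measurable_id.prodMk measurable_const))))).const_mul _).add_const β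
    simp only [fGPRBiased, gprMean, Matrix.mulVec, dotProduct]
    exact Finset.measurable_fun_sum _ fun i _ => Measurable.fun_mul
      (hk.measurable.comp (hact'.prodMk measurable_const))
      (Finset.measurable_fun_sum _ fun j _ =>
        ((hMCt (ytr j)).comp measurable_snd).const_mul _)
  have hsample : ∀ i, eLpNorm (fun p : E D × Ω =>
      f p.1 - f (recombine hd Wc (activeVar hd Wc p.1) (Z i p.2 (activeVar hd Wc p.1)))) 2
      ((densityMeasure ρ).prod P) ≤ ENNReal.ofReal (C₁ * S) := by
    intro i
    have h1 := lintegral_sq_sub_sample_le hd hα hc hρ hV hcomp hWc hf hfd P (hZ.measurable i)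
      (hZ.law i)
    have h2 := h1.trans (mul_le_mul' hC₀C₁
      (lintegral_inactiveVar_gradient_le hd hg hW hWc hδ))
    rw [← ENNReal.ofReal_mul (sq_nonneg _), ← mul_pow,
      ENNReal.ofReal_pow (mul_nonneg hC₁0 hS0)] at h2
    rw [eLpNorm_eq_lintegral_rpow_enorm_toReal two_ne_zero ENNReal.ofNat_ne_top,
      lintegral_prod _ (by
        simp only [ENNReal.toReal_ofNat, ENNReal.rpow_ofNat]
        exact ((hfx.sub (hfz i)).enorm.pow_const 2).aemeasurable)]
    simp only [ENNReal.toReal_ofNat, ENNReal.rpow_ofNat]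
    calc _ ≤ (ENNReal.ofReal (C₁ * S) ^ 2) ^ (1 / 2 : ℝ) := ENNReal.rpow_le_rpow h2 (by norm_num)
      _ = ENNReal.ofReal (C₁ * S) := by
        rw [← ENNReal.rpow_natCast, ← ENNReal.rpow_mul]; simp
  have hN0 : (N : ℝ) ≠ 0 := by exact_mod_cast hN.ne'
  -- The error is the average of the `N` single-sample errors, shifted by `-β`; Minkowski's
  -- inequality bounds the average by the common bound `C₁ * S`.
  have hMC : rmsNorm ρ P (fun ω x => f x - fMCBiased hd Wc f Z β ω (activeVar hd Wc x))
      ≤ ENNReal.ofReal (C₁ * S) + ENNReal.ofReal β := by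
    have e : (fun p : E D × Ω => f p.1 - fMCBiased hd Wc f Z β p.2 (activeVar hd Wc p.1))
        = ((1 / (N : ℝ)) • ∑ i, fun p : E D × Ω => f p.1 -
            f (recombine hd Wc (activeVar hd Wc p.1) (Z i p.2 (activeVar hd Wc p.1))))
          + fun _ => -β := by
      funext p
      simp only [fMCBiased, fMC, Pi.add_apply, Pi.smul_apply, Finset.sum_apply, smul_eq_mul,
        Finset.sum_sub_distrib, Finset.sum_const, Finset.card_univ, Fintype.card_fin, nsmul_eq_mul]
      field_simp
      ring
    rw [rmsNorm, e]
    refine (eLpNorm_add_le ?_ aestronglyMeasurable_const one_le_two).trans (add_le_add ?_ ?_)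
    · refine AEStronglyMeasurable.const_smul ?_ _
      exact Finset.aestronglyMeasurable_sum _ fun i _ =>
        (hfx.sub (hfz i)).aestronglyMeasurable
    · rw [eLpNorm_const_smul]
      refine (mul_le_mul' le_rfl ((eLpNorm_sum_le (fun i _ =>
        (hfx.sub (hfz i)).aestronglyMeasurable) one_le_two).trans
          (Finset.sum_le_sum fun i _ => hsample i))).trans (le_of_eq ?_)
      rw [Finset.sum_const, Finset.card_univ, Fintype.card_fin, nsmul_eq_mul, ← mul_assoc,
        Real.enorm_of_nonneg (by positivity), ← ENNReal.ofReal_natCast N,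
        ← ENNReal.ofReal_mul (by positivity), one_div, inv_mul_cancel₀ hN0, ENNReal.ofReal_one,
        one_mul]
    · rw [eLpNorm_const _ two_ne_zero (NeZero.ne _), enorm_neg, Real.enorm_of_nonneg hβ]
      simp
  have htri : rmsNorm ρ P (fun ω x => f x - fGPRBiased hd Wc f Z k ytr β ω (activeVar hd Wc x))
      ≤ rmsNorm ρ P (fun ω x => f x - fMCBiased hd Wc f Z β ω (activeVar hd Wc x))
        + rmsNorm ρ P (fun ω x => fMCBiased hd Wc f Z β ω (activeVar hd Wc x)
            - fGPRBiased hd Wc f Z k ytr β ω (activeVar hd Wc x)) := by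
    refine le_trans (le_of_eq ?_) (eLpNorm_add_le (hfx.sub hMCm).aestronglyMeasurable
      (hMCm.sub hGPRm).aestronglyMeasurable one_le_two)
    rw [rmsNorm]
    congr 1
    funext p
    simp
  refine (htri.trans (add_le_add hMC hgpr)).trans ?_
  rw [← ENNReal.ofReal_add (by positivity) hβ, ← ENNReal.ofReal_add (by positivity) (by positivity)]
  refine ENNReal.ofReal_le_ofReal ?_
  -- The estimate already holds with factor `1`, which is at most `1 + 1/√N`.
  have h1 : C₁ * S ≤ C₁ * (1 + 1 / Real.sqrt N) * S := by
    have : 0 ≤ C₁ * (1 / Real.sqrt N) * S := by positivity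
    nlinarith
  linarith
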